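/- There is an absolute constant $c>0$ such that the following holds for all integers $n\ge 3$ and all real $\varepsilon>0$. Let $m\ge 0$ be an integer, and let $\mathcal A$ be a (possibly randomized) algorithm that takes $m$ samples in $\mathbb R^n$ as input. Suppose that, for every nonsingular zero-mean Gaussian distribution $P=N(0,\Sigma)$ on $\mathbb R^n$, when $\mathcal A$ is run on $m$ independent samples from $P$, it outputs with probability at least $9/10$ an $\varepsilon/200$-approximate tree for $P$. Then $$m\;\ge\; c\,\frac{n^2}{\varepsilon^2}.$$ That is, $\Omega(n^2/\varepsilon^2)$ samples are necessary. Here, for a tree $T$ on the vertex set $[n]$, a probability distribution $Q$ on $\mathbb R^n$ is called $T$-structured if, for some orientation of $T$ away from a root $r$ in which $pa(i)$ denotes the parent of $i\neq r$, each coordinate $X_i$, $i\ne r$, is under $Q$ conditionally independent, given $X_{pa(i)}$, of the coordinates $X_j$ for the vertices $j$ not reachable from $i$, and $Q$ has a Lebesgue density that factorizes as $Q(x)=Q(x_r)\prod_{i\ne r}Q(x_i\mid x_{pa(i)})$. A tree $T$ on $[n]$ is an $\eta$-approximate tree for $P$ if there is a $T$-structured distribution $Q$ with $$D_{\mathrm{KL}}(P\|Q)\;\le\;\eta+\inf_{T'}\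 \inf_{Q'\ T'\text{-structured}} D_{\mathrm{KL}}(P\|Q'),$$ where $T'$ ranges over all trees on $[n]$. -/

import Mathlib

open MeasureTheory ProbabilityTheory
open scoped ENNReal

namespace GaussianTree

/-- `ℝⁿ`, the space in which one sample of an `n`-variate distribution lives. -/
abbrev Sample (n : ℕ) : Type := EuclideanSpace ℝ (Fin n)

/-- Undirected graphs on `{0, …, n-1}` form a finite set; every set of graphs is measurable. -/
instance instMeasurableSpaceGraph (n : ℕ) : MeasurableSpace (SimpleGraph (Fin n)) := ⊤

/-- `Arc T r a b`: in the orientation of the tree `T` away from the root `r`, there is an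
arc from `a` to `b`, i.e. `a` is the parent of `b`. -/
def Arc {n : ℕ} (T : SimpleGraph (Fin n)) (r a b : Fin n) : Prop :=
  T.Adj a b ∧ T.dist r b = T.dist r a + 1

/-- The set `nd(i)` of vertices that are not reachable from `i` in the orientation of `T`
away from the root `r`. -/
def nonDesc {n : ℕ} (T : SimpleGraph (Fin n)) (r i : Fin n) : Set (Fin n) :=
  {j | ¬ Relation.ReflTransGen (Arc T r) i j}

/-- Each non-root coordinate `X_i` is conditionally independent of `(X_j)_{j ∈ nd(i)}`
given the parent coordinate `X_{pa(i)}`. -/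
def MarkovProperty {n : ℕ} (T : SimpleGraph (Fin n)) (r : Fin n) (pa : Fin n → Fin n)
    (Q : Measure (Sample n)) [IsFiniteMeasure Q] : Prop :=
  ∀ i, i ≠ r →
    CondIndepFun
      (MeasurableSpace.comap (fun x : Sample n => x (pa i)) inferInstance)
      (Measurable.comap_le (by fun_prop : Measurable (fun x : Sample n => x (pa i))))
      (fun x : Sample n => x i)
      (fun (x : Sample n) (j : nonDesc T r i) => x j.1) Q

/-- `Q` has a Lebesgue density of the form `f(x_r) ∏_{i ≠ r} k_i(x_i | x_{pa(i)})`, where `f`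
is a probability density and `k_i(· | y)` is a probability density for every `y`
(so `f` is the density of `X_r` and `k_i` the conditional density of `X_i` given `X_{pa(i)}`). -/
def HasTreeDensity {n : ℕ} (r : Fin n) (pa : Fin n → Fin n) (Q : Measure (Sample n)) : Prop :=
  ∃ (f : ℝ → ℝ≥0∞) (k : Fin n → ℝ → ℝ → ℝ≥0∞),
    Measurable f ∧ ∫⁻ z, f z = 1 ∧
    (∀ i, Measurable (Function.uncurry (k i))) ∧ (∀ i y, ∫⁻ z, k i y z = 1) ∧
    Q = (volume : Measure (Sample n)).withDensity
      (fun x => f (x r) * ∏ i ∈ Finset.univ.erase r, k i (x (pa i)) (x i))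

/-- `Q` is a `T`-structured distribution: for some rooted orientation of `T`, with parent
map `pa`, the conditional independences and the density factorization along `T` hold. -/
def IsStructured {n : ℕ} (T : SimpleGraph (Fin n)) (Q : ProbabilityMeasure (Sample n)) : Prop :=
  ∃ (r : Fin n) (pa : Fin n → Fin n), (∀ i, i ≠ r → Arc T r (pa i) i) ∧
    MarkovProperty T r pa (Q : Measure (Sample n)) ∧
    HasTreeDensity r pa (Q : Measure (Sample n))

/-- The least Kullback-Leibler divergence `KL(P ‖ Q)` to a tree-structured distribution `Q`. -/
noncomputable def optTreeDiv {n : ℕ} (P : Measure (Sample n)) : ℝ≥0∞ :=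
  ⨅ (T : SimpleGraph (Fin n)) (_ : T.IsTree)
    (Q : ProbabilityMeasure (Sample n)) (_ : IsStructured T Q),
      InformationTheory.klDiv P (Q : Measure (Sample n))

/-- `T` is an `η`-approximate tree for the distribution `P`. -/
def IsApproxTree {n : ℕ} (P : Measure (Sample n)) (η : ℝ) (T : SimpleGraph (Fin n)) : Prop :=
  T.IsTree ∧ ∃ Q : ProbabilityMeasure (Sample n), IsStructured T Q ∧
    InformationTheory.klDiv P (Q : Measure (Sample n)) ≤ ENNReal.ofReal η + optTreeDiv P

/-- A (possibly randomized) algorithm that maps `m` samples in `ℝⁿ` to a graph on `n` vertices: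
a Markov kernel. `Succeeds A η p` says that, for every nonsingular zero-mean Gaussian
distribution `P`, when `A` is run on `m` independent samples from `P`, its output is an
`η`-approximate tree for `P` with probability at least `p`. -/
def Succeeds {n m : ℕ} (A : Kernel (Fin m → Sample n) (SimpleGraph (Fin n)))
    (η : ℝ) (p : ℝ≥0∞) : Prop :=
  ∀ S : Matrix (Fin n) (Fin n) ℝ, S.PosDef →
    p ≤ ((Measure.pi fun _ : Fin m => multivariateGaussian 0 S).bind A)
      {T | IsApproxTree (multivariateGaussian 0 S) η T}

end GaussianTree

/-!
The lower bound combines a reduction to mutual information with Assouad's method.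

*Loss of a tree.* Let `P = N(0, S)` where `S` has unit diagonal, and let `Q` be any distribution
structured along a tree `T` with parent map `pa`. The density of `Q` is a product of one factor
per vertex, and so is the density of the Gaussian `Q₀` in which `X_i` is regressed on its parent
alone (`treeMeasure`). Under `P`, the ratio of a factor of `Q` to the corresponding factor of `Q₀`
has mean one, because the latter is the conditional density of `X_i` given `X_{pa i}` under `P`;
with `log t ≤ t - 1` this gives `KL(P ‖ Q₀) ≤ KL(P ‖ Q)` (`treeDiv_le_klDiv`). Here `KL(P ‖ Q₀)` is
a constant that does not depend on the tree, minus the sum of the mutual informations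
`-(1/2) log (1 - S_{pa i, i}²)` over the edges (`klDiv_treeDensity`, `treeDiv_eq`). As `Q₀` is
structured along its tree, the edges of an `η`-approximate tree carry at least the total mutual
information of the edges of any other tree, up to `η`
(`IsApproxTree.exists_le_sum_mutualInfo`). No chain rule for relative entropy is needed.

*Hard family.* The vertices are cut into `⌊n/3⌋` independent blocks of three. In every block, one of
two designated vertices is the center: it has correlation `a = 1/4 + ε/n` with the two other
vertices, which have correlation `b = 1/4` (`blockCov`). A tree that misses an edge at the center
of a block loses mutual information of order `ε/n` there, so an `ε/200`-approximate tree is wrong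
in few blocks (`card_wrongAt_le`). Moving the center of one block swaps two correlations, and the
two Gaussian laws have divergence of order `(ε/n)²`. If `m` is small compared with `n²/ε²`, a
two-point testing bound (`IsSwapPair.testing_error_ge`) shows that, averaged over the choices of
the centers, the output is wrong about each block with a probability that is too large for an
algorithm that succeeds with probability `9/10` (`Succeeds.averaging`).

*Large `ε`.* When `ε ≥ n/8` the bound only says `m ≥ 1`. Without samples the output law does not
depend on `P`; three laws with one strongly correlated pair each would force the three edges of a
triangle into the same tree (`Succeeds.pos`).
-/

namespace GaussianTree

/-! ### Densities of product measures -/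

theorem lintegral_fin_prod_eq_prod {n : ℕ} {E : Fin n → Type*}
    [∀ i, MeasurableSpace (E i)] (μ : ∀ i, Measure (E i)) [∀ i, SigmaFinite (μ i)]
    (f : ∀ i, E i → ℝ≥0∞) (hf : ∀ i, Measurable (f i)) :
    ∫⁻ x, ∏ i, f i (x i) ∂(Measure.pi μ) = ∏ i, ∫⁻ x, f i x ∂(μ i) := by
  induction n with
  | zero => simp
  | succ n ih =>
    calc
      _ = ∫⁻ x : E 0 × (∀ i : Fin n, E i.succ), f 0 x.1 * ∏ i : Fin n, f i.succ (x.2 i)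
          ∂((μ 0).prod (Measure.pi fun i : Fin n => μ i.succ)) := by
        rw [← (measurePreserving_piFinSuccAbove μ 0).symm.lintegral_comp_emb
          (MeasurableEquiv.measurableEmbedding _)]
        simp_rw [MeasurableEquiv.piFinSuccAbove_symm_apply, Fin.insertNthEquiv,
          Fin.prod_univ_succ, Fin.insertNth_zero, Equiv.coe_fn_mk, Fin.cons_succ,
          Fin.zero_succAbove, Fin.cons_zero]
        rfl
      _ = (∫⁻ x, f 0 x ∂μ 0) * ∏ i : Fin n, ∫⁻ x, f i.succ x ∂(μ i.succ) := by
        rw [← ih (fun i => μ i.succ) (fun i => f i.succ) fun i => hf i.succ]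
        exact lintegral_prod_mul (hf 0).aemeasurable
          (Finset.measurable_prod Finset.univ fun (i : Fin n) _ =>
            (hf i.succ).comp (measurable_pi_apply i)).aemeasurable
      _ = _ := by rw [Fin.prod_univ_succ]

theorem pi_withDensity_fin {n : ℕ} {E : Fin n → Type*}
    [∀ i, MeasurableSpace (E i)] (μ : ∀ i, Measure (E i)) [∀ i, SigmaFinite (μ i)]
    (f : ∀ i, E i → ℝ≥0∞) (hf : ∀ i, Measurable (f i))
    [∀ i, SigmaFinite ((μ i).withDensity (f i))] :
    Measure.pi (fun i => (μ i).withDensity (f i))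
      = (Measure.pi μ).withDensity (fun x => ∏ i, f i (x i)) := by
  refine Measure.pi_eq fun s hs => ?_
  rw [withDensity_apply _ (MeasurableSet.univ_pi hs), ← lintegral_indicator (.univ_pi hs)]
  calc
    _ = ∫⁻ x, ∏ i, (s i).indicator (f i) (x i) ∂(Measure.pi μ) := by
      refine lintegral_congr fun x => ?_
      by_cases hx : x ∈ Set.univ.pi s
      · rw [Set.indicator_of_mem hx]
        exact Finset.prod_congr rfl fun i _ =>
          (Set.indicator_of_mem (hx i (Set.mem_univ i)) _).symm
      · rw [Set.indicator_of_notMem hx]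
        obtain ⟨i, hi⟩ : ∃ i, x i ∉ s i := by simpa using hx
        exact (Finset.prod_eq_zero (Finset.mem_univ i) (Set.indicator_of_notMem hi _)).symm
    _ = _ := by
      rw [lintegral_fin_prod_eq_prod μ _ fun i => (hf i).indicator (hs i)]
      exact Finset.prod_congr rfl fun i _ => by
        rw [lintegral_indicator (hs i), withDensity_apply _ (hs i)]

theorem map_withDensity_equiv {α β : Type*} [MeasurableSpace α] [MeasurableSpace β]
    (e : α ≃ᵐ β) (μ : Measure α) (f : α → ℝ≥0∞) :
    (μ.withDensity f).map e = (μ.map e).withDensity (f ∘ e.symm) := by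
  ext s hs
  rw [Measure.map_apply e.measurable hs, withDensity_apply _ (e.measurable hs),
    withDensity_apply _ hs, e.restrict_map, lintegral_map_equiv]
  simp

/-! ### The density of a nonsingular Gaussian law -/

open Matrix

theorem stdGaussian_eq_withDensity (n : ℕ) :
    stdGaussian (Sample n)
      = volume.withDensity (fun x => ∏ i, gaussianPDF 0 1 (x i)) := by
  have h : Measure.pi (fun _ : Fin n => gaussianReal 0 1)
      = (volume : Measure (Fin n → ℝ)).withDensity (fun x => ∏ i, gaussianPDF 0 1 (x i)) := by
    have : ∀ _ : Fin n, SigmaFinite ((volume : Measure ℝ).withDensity (gaussianPDF 0 1)) := by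
      intro i; rw [← gaussianReal_of_var_ne_zero 0 one_ne_zero]; infer_instance
    simp_rw [gaussianReal_of_var_ne_zero 0 (one_ne_zero : (1 : NNReal) ≠ 0)]
    exact @pi_withDensity_fin n (fun _ => ℝ) _ (fun _ => volume) _ (fun _ => gaussianPDF 0 1)
      (fun _ => measurable_gaussianPDF 0 1) this
  rw [← map_pi_eq_stdGaussian, h]
  have := map_withDensity_equiv (MeasurableEquiv.toLp 2 (Fin n → ℝ)) volume
    (fun x => ∏ i, gaussianPDF 0 1 (x i))
  rw [MeasurableEquiv.coe_toLp, (PiLp.volume_preserving_toLp (Fin n)).map_eq] at this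
  rw [this]
  rfl

/-- The logarithm of the Lebesgue density of `N(0, S)`, for a positive definite `S`. -/
noncomputable def logDensity {n : ℕ} (S : Matrix (Fin n) (Fin n) ℝ) (x : Sample n) : ℝ :=
  -(n * Real.log (2 * Real.pi) + Real.log S.det) / 2 - (x.ofLp ⬝ᵥ S⁻¹ *ᵥ x.ofLp) / 2

theorem prod_gaussianPDF_zero_one {n : ℕ} (x : Fin n → ℝ) :
    ∏ i, gaussianPDF 0 1 (x i)
      = ENNReal.ofReal (Real.exp (-(n * Real.log (2 * Real.pi)) / 2 - (x ⬝ᵥ x) / 2)) := by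
  have h : ∀ i, gaussianPDF 0 1 (x i)
      = ENNReal.ofReal (Real.exp (-Real.log (2 * Real.pi) / 2 - x i * x i / 2)) := by
    intro i
    rw [gaussianPDF, gaussianPDFReal]
    congr 1
    have hp : (0 : ℝ) < 2 * Real.pi := by positivity
    have hc : Real.exp (-Real.log (2 * Real.pi) / 2) = (√(2 * Real.pi))⁻¹ := by
      rw [Real.exp_half, Real.exp_neg, Real.exp_log hp, Real.sqrt_inv]
    rw [sub_eq_add_neg (_ / _), Real.exp_add, hc]
    simp [pow_two, neg_div]
  simp_rw [h]
  rw [← ENNReal.ofReal_prod_of_nonneg fun i _ => (Real.exp_pos _).le, ← Real.exp_sum]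
  congr 2
  rw [Finset.sum_sub_distrib, ← Finset.sum_div, ← Finset.sum_div, dotProduct]
  simp

/-- The measurable equivalence `x ↦ R x` of `ℝⁿ` for an invertible matrix `R`. -/
noncomputable def linearMeasurableEquiv {n : ℕ} (R : Matrix (Fin n) (Fin n) ℝ)
    (hR : IsUnit R.det) : Sample n ≃ᵐ Sample n where
  toFun := toEuclideanCLM (𝕜 := ℝ) R
  invFun := toEuclideanCLM (𝕜 := ℝ) R⁻¹
  left_inv x := by
    apply WithLp.ofLp_injective
    simp [Matrix.nonsing_inv_mul _ hR]
  right_inv x := by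
    apply WithLp.ofLp_injective
    simp [Matrix.mul_nonsing_inv _ hR]
  measurable_toFun := (toEuclideanCLM (𝕜 := ℝ) R).continuous.measurable
  measurable_invFun := (toEuclideanCLM (𝕜 := ℝ) R⁻¹).continuous.measurable

theorem map_linearMeasurableEquiv {n : ℕ} (R : Matrix (Fin n) (Fin n) ℝ) (hR : IsUnit R.det) :
    (volume : Measure (Sample n)).map (linearMeasurableEquiv R hR)
      = ENNReal.ofReal |R.det⁻¹| • volume := by
  have hdet : LinearMap.det (toEuclideanLin (𝕜 := ℝ) R) = R.det := by
    simp [toEuclideanLin, Matrix.toLpLin_eq_toLin, LinearMap.det_toLin]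
  rw [← hdet, ← Measure.map_linearMap_addHaar_eq_smul_addHaar _ (by rw [hdet]; exact hR.ne_zero)]
  rfl

/-- `N(0, S)` is the image of the standard Gaussian law under the square root of `S`. -/
theorem multivariateGaussian_eq_withDensity {n : ℕ} {S : Matrix (Fin n) (Fin n) ℝ}
    (hS : S.PosDef) :
    multivariateGaussian 0 S
      = volume.withDensity (fun x => ENNReal.ofReal (Real.exp (logDensity S x))) := by
  open scoped MatrixOrder in
  set R := CFC.sqrt S with hR
  have hRR : R * R = S := CFC.sqrt_mul_sqrt_self S hS.posSemidef.nonneg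
  have hRsa : Rᵀ = R := by
    have := (CFC.sqrt_nonneg S).isSelfAdjoint
    simpa [IsSelfAdjoint, Matrix.star_eq_conjTranspose] using this
  have hdet : R.det * R.det = S.det := by rw [← det_mul, hRR]
  have hR0 : R.det ≠ 0 := fun h => hS.det_pos.ne' (by rw [← hdet, h, zero_mul])
  have hRu : IsUnit R.det := isUnit_iff_ne_zero.2 hR0
  let e := linearMeasurableEquiv R hRu
  have h1 : multivariateGaussian 0 S = (stdGaussian (Sample n)).map e := by
    rw [multivariateGaussian]
    congr 1
    funext x
    simp only [zero_add]
    rfl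
  have hmeas : Measurable fun x : Sample n => ENNReal.ofReal (Real.exp (logDensity S x)) := by
    unfold logDensity dotProduct mulVec dotProduct
    fun_prop
  rw [h1, stdGaussian_eq_withDensity, map_withDensity_equiv, map_linearMeasurableEquiv,
    withDensity_smul_measure, ← withDensity_smul' _ _ ENNReal.ofReal_ne_top]
  congr 1
  funext x
  obtain ⟨y, rfl⟩ := e.surjective x
  have hy : (e y).ofLp = R *ᵥ y.ofLp := by
    rfl
  simp only [Pi.smul_apply, Function.comp, e.symm_apply_apply, prod_gaussianPDF_zero_one,
    smul_eq_mul]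
  rw [← ENNReal.ofReal_mul (abs_nonneg _)]
  congr 1
  rw [logDensity, hy]
  have hq : (R *ᵥ y.ofLp) ⬝ᵥ S⁻¹ *ᵥ (R *ᵥ y.ofLp) = y.ofLp ⬝ᵥ y.ofLp := by
    rw [← hRR, Matrix.mul_inv_rev, mulVec_mulVec, Matrix.mul_assoc,
      Matrix.nonsing_inv_mul _ hRu, Matrix.mul_one, ← hRsa, mulVec_transpose, hRsa,
      ← dotProduct_mulVec, mulVec_mulVec, Matrix.mul_nonsing_inv _ hRu, one_mulVec]
  have habs : |R.det⁻¹| = Real.exp (-Real.log S.det / 2) := by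
    rw [← hdet, Real.log_mul hR0 hR0, ← Real.log_abs, abs_inv,
      show -(Real.log |R.det| + Real.log |R.det|) / 2 = -Real.log |R.det| by ring, Real.exp_neg,
      Real.exp_log (abs_pos.2 hR0)]
  rw [hq, habs, ← Real.exp_add]
  congr 1
  ring

/-! ### Moments and regressions of a Gaussian law -/

section Moments

variable {n : ℕ} {S : Matrix (Fin n) (Fin n) ℝ}

theorem memLp_two_coord (i : Fin n) :
    MemLp (fun x : Sample n => x i) 2 (multivariateGaussian 0 S) :=
  (EuclideanSpace.proj (𝕜 := ℝ) i).comp_memLp' IsGaussian.memLp_two_id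

theorem integrable_coord_mul_coord (i j : Fin n) :
    Integrable (fun x : Sample n => x i * x j) (multivariateGaussian 0 S) :=
  (memLp_two_coord i).integrable_mul (memLp_two_coord j)

theorem integral_coord (i : Fin n) :
    ∫ x : Sample n, x i ∂(multivariateGaussian 0 S) = 0 := by
  have := ContinuousLinearMap.integral_comp_id_comm (μ := multivariateGaussian 0 S)
    IsGaussian.integrable_id (EuclideanSpace.proj (𝕜 := ℝ) i)
  simpa using this

theorem integral_coord_mul_coord (hS : S.PosSemidef) (i j : Fin n) :
    ∫ x : Sample n, x i * x j ∂(multivariateGaussian 0 S) = S i j := by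
  rw [← covariance_eval_multivariateGaussian (μ := 0) hS i j,
    covariance_eq_sub (memLp_two_coord i) (memLp_two_coord j), integral_coord, integral_coord]
  simp

theorem integrable_logDensity :
    Integrable (logDensity S) (multivariateGaussian 0 S) := by
  unfold logDensity dotProduct mulVec dotProduct
  refine (integrable_const _).sub (Integrable.div_const (integrable_finsetSum _ fun i _ => ?_) _)
  simp_rw [Finset.mul_sum]
  refine integrable_finsetSum _ fun j _ => ?_
  convert! (integrable_coord_mul_coord (S := S) i j).const_mul (S⁻¹ i j) using 2
  ring

theorem sq_entry_lt_one (hS : S.PosDef) (hd : ∀ i, S i i = 1) {i j : Fin n} (hij : i ≠ j) :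
    S i j ^ 2 < 1 := by
  have hsym : S j i = S i j := by simpa using hS.1.apply i j
  -- the residual of the regression of one coordinate on the other has positive variance
  have h := hS.dotProduct_mulVec_pos (x := Pi.single i 1 - S i j • Pi.single j 1) (by
    intro h
    have := congrFun h i
    simp [hij] at this)
  simp [mulVec_sub, mulVec_smul, sub_dotProduct, dotProduct_sub, hd, hsym] at h
  nlinarith

/-- The variance of the residual when a standardised coordinate is regressed on another
one, at correlation `a`. -/
noncomputable def residVar (a : ℝ) : NNReal := (1 - a ^ 2).toNNReal

theorem coe_residVar {a : ℝ} (ha : a ^ 2 < 1) : (residVar a : ℝ) = 1 - a ^ 2 :=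
  Real.coe_toNNReal _ (by linarith)

theorem residVar_ne_zero {a : ℝ} (ha : a ^ 2 < 1) : residVar a ≠ 0 := by
  rw [residVar, Ne, Real.toNNReal_eq_zero]; linarith

theorem map_coord_eq_gaussianReal (hS : S.PosDef) (hd : ∀ i, S i i = 1) (i : Fin n) :
    (multivariateGaussian 0 S).map (fun x : Sample n => x i) = gaussianReal 0 1 := by
  rw [(measurePreserving_eval_multivariateGaussian (μ := 0) hS.posSemidef (i := i)).map_eq]
  simp [hd]

theorem integral_resid_sq (hS : S.PosDef) (hd : ∀ i, S i i = 1) (i j : Fin n) :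
    ∫ x : Sample n, (x i - S j i * x j) ^ 2 ∂(multivariateGaussian 0 S) = 1 - S j i ^ 2 := by
  have hsym : S i j = S j i := by simpa using hS.1.apply j i
  have h : ∀ x : Sample n, (x i - S j i * x j) ^ 2
      = x i * x i - 2 * S j i * (x i * x j) + S j i ^ 2 * (x j * x j) := fun x => by ring
  simp_rw [h]
  rw [integral_add, integral_sub, integral_const_mul, integral_const_mul,
    integral_coord_mul_coord hS.posSemidef, integral_coord_mul_coord hS.posSemidef,
    integral_coord_mul_coord hS.posSemidef, hd, hd, hsym]
  · ring
  · exact integrable_coord_mul_coord i i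
  · exact (integrable_coord_mul_coord i j).const_mul _
  · exact (integrable_coord_mul_coord i i).sub ((integrable_coord_mul_coord i j).const_mul _)
  · exact (integrable_coord_mul_coord j j).const_mul _

/-- A coordinate and the residual of the regression of another coordinate on it are
independent. -/
theorem map_coord_resid (hS : S.PosDef) (hd : ∀ i, S i i = 1) (i j : Fin n) :
    (multivariateGaussian 0 S).map (fun x : Sample n => (x j, x i - S j i * x j))
      = (gaussianReal 0 1).prod (gaussianReal 0 (residVar (S j i))) := by
  have hsym : S i j = S j i := by simpa using hS.1.apply j i
  let R : Sample n →L[ℝ] ℝ :=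
    EuclideanSpace.proj (𝕜 := ℝ) i - S j i • EuclideanSpace.proj (𝕜 := ℝ) j
  have hR : (fun x : Sample n => x i - S j i * x j) = R := by
    funext x; simp [R]
  have hlaw : (multivariateGaussian 0 S).map (fun x : Sample n => x i - S j i * x j)
      = gaussianReal 0 (residVar (S j i)) := by
    rw [hR, IsGaussian.map_eq_gaussianReal]
    have h0 : ∫ x, R x ∂(multivariateGaussian 0 S) = 0 := by
      rw [ContinuousLinearMap.integral_comp_id_comm IsGaussian.integrable_id R]; simp
    rw [h0, variance_of_integral_eq_zero R.continuous.aemeasurable h0, ← hR, residVar,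
      integral_resid_sq hS hd]
  have hg : HasGaussianLaw (fun x : Sample n => (x j, x i - S j i * x j))
      (multivariateGaussian 0 S) := by
    constructor
    have : (fun x : Sample n => (x j, x i - S j i * x j))
        = (EuclideanSpace.proj (𝕜 := ℝ) j).prod R := by
      funext x; simp [R]
    rw [this]
    infer_instance
  have hind : IndepFun (fun x : Sample n => x j) (fun x => x i - S j i * x j)
      (multivariateGaussian 0 S) := by
    refine hg.indepFun_of_covariance_eq_zero ?_
    rw [covariance_fun_sub_right (memLp_two_coord j) (memLp_two_coord i)
      ((memLp_two_coord j).const_mul _), covariance_const_mul_right,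
      covariance_eval_multivariateGaussian hS.posSemidef,
      covariance_eval_multivariateGaussian hS.posSemidef, hd]
    ring
  rw [(indepFun_iff_map_prod_eq_prod_map_map (by fun_prop) (by fun_prop)).1 hind, hlaw,
    map_coord_eq_gaussianReal hS hd]

theorem integrable_resid_sq (i j : Fin n) (a : ℝ) :
    Integrable (fun x : Sample n => (x i - a * x j) ^ 2) (multivariateGaussian 0 S) :=
  ((memLp_two_coord i).sub ((memLp_two_coord j).const_mul a)).integrable_sq

/-- The likelihood ratio of an arbitrary density against the marginal density of a Gaussian
coordinate has mean one. -/
theorem lintegral_div_gaussianPDF (hS : S.PosDef) (hd : ∀ i, S i i = 1) (i : Fin n)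
    {f : ℝ → ℝ≥0∞} (hf : Measurable f) :
    ∫⁻ x : Sample n, f (x i) / gaussianPDF 0 1 (x i) ∂(multivariateGaussian 0 S)
      = ∫⁻ z, f z := by
  have hm : Measurable fun z => f z / gaussianPDF 0 1 z := hf.div (measurable_gaussianPDF 0 1)
  rw [← lintegral_map (μ := multivariateGaussian 0 S) (g := fun x : Sample n => x i) hm
    (by fun_prop), map_coord_eq_gaussianReal hS hd, gaussianReal_of_var_ne_zero 0 one_ne_zero,
    lintegral_withDensity_eq_lintegral_mul _ (measurable_gaussianPDF 0 1) hm]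
  refine lintegral_congr fun z => ?_
  exact ENNReal.mul_div_cancel (gaussianPDF_pos 0 one_ne_zero z).ne' gaussianPDF_ne_top

/-- The likelihood ratio of an arbitrary conditional density against the Gaussian conditional
density of one coordinate given another one has mean one. -/
theorem lintegral_div_gaussianPDF_resid (hS : S.PosDef) (hd : ∀ i, S i i = 1) {i j : Fin n}
    (hij : j ≠ i) {k : ℝ → ℝ → ℝ≥0∞} (hk : Measurable (Function.uncurry k))
    (hk1 : ∀ y, ∫⁻ z, k y z = 1) :
    ∫⁻ x : Sample n, k (x j) (x i) / gaussianPDF 0 (residVar (S j i)) (x i - S j i * x j)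
      ∂(multivariateGaussian 0 S) = 1 := by
  set v := residVar (S j i) with hv
  have hv0 : v ≠ 0 := residVar_ne_zero (sq_entry_lt_one hS hd hij)
  have hk' : Measurable fun p : ℝ × ℝ => k p.1 (S j i * p.1 + p.2) :=
    hk.comp (by fun_prop : Measurable fun p : ℝ × ℝ => (p.1, S j i * p.1 + p.2))
  have hm : Measurable fun p : ℝ × ℝ => k p.1 (S j i * p.1 + p.2) / gaussianPDF 0 v p.2 :=
    hk'.div ((measurable_gaussianPDF 0 v).comp measurable_snd)
  calc
    _ = ∫⁻ p, k p.1 (S j i * p.1 + p.2) / gaussianPDF 0 v p.2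
          ∂((multivariateGaussian 0 S).map
            (fun x : Sample n => (x j, x i - S j i * x j))) := by
      rw [lintegral_map hm (by fun_prop)]
      refine lintegral_congr fun x => ?_
      simp
    _ = ∫⁻ y, ∫⁻ z, k y (S j i * y + z) / gaussianPDF 0 v z ∂(gaussianReal 0 v)
          ∂(gaussianReal 0 1) := by
      rw [map_coord_resid hS hd i j, lintegral_prod _ hm.aemeasurable]
    _ = ∫⁻ y, 1 ∂(gaussianReal 0 1) := by
      refine lintegral_congr fun y => ?_
      rw [gaussianReal_of_var_ne_zero 0 hv0,
        lintegral_withDensity_eq_lintegral_mul _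
          (f := gaussianPDF 0 v) (g := fun z => k y (S j i * y + z) / gaussianPDF 0 v z)
          (measurable_gaussianPDF 0 v) (hm.comp (by fun_prop : Measurable fun z : ℝ => (y, z)))]
      calc
        _ = ∫⁻ z, k y (S j i * y + z) := lintegral_congr fun z =>
          ENNReal.mul_div_cancel (gaussianPDF_pos 0 hv0 z).ne' gaussianPDF_ne_top
        _ = ∫⁻ z, k y z := lintegral_add_left_eq_self (k y) _
        _ = 1 := hk1 y
    _ = 1 := by simp

end Moments

/-! ### Divergence to tree-structured distributions -/

/-- For two laws with Lebesgue densities `exp ℓ` and `q`, the log-likelihood ratio is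
`ℓ - log q`. -/
theorem llr_ae_eq_sub {α : Type*} [MeasurableSpace α] {μ : Measure α} [SigmaFinite μ]
    {ℓ : α → ℝ} {q : α → ℝ≥0∞} (hℓ : Measurable ℓ) (hq : Measurable q)
    [SigmaFinite (μ.withDensity fun x => ENNReal.ofReal (Real.exp (ℓ x)))]
    [IsFiniteMeasure (μ.withDensity q)]
    (hac : (μ.withDensity fun x => ENNReal.ofReal (Real.exp (ℓ x))) ≪ μ.withDensity q) :
    ∀ᵐ x ∂(μ.withDensity fun x => ENNReal.ofReal (Real.exp (ℓ x))),
      q x ≠ 0 ∧ q x ≠ ∞ ∧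
      llr (μ.withDensity fun x => ENNReal.ofReal (Real.exp (ℓ x))) (μ.withDensity q) x
        = ℓ x - Real.log (q x).toReal := by
  have hm : Measurable fun x => ENNReal.ofReal (Real.exp (ℓ x)) := by fun_prop
  set P := μ.withDensity fun x => ENNReal.ofReal (Real.exp (ℓ x)) with hP
  set Q := μ.withDensity q with hQ
  have hPμ : P ≪ μ := withDensity_absolutelyContinuous _ _
  have hQμ : Q ≪ μ := withDensity_absolutelyContinuous _ _
  have h0 : ∀ᵐ x ∂Q, q x ≠ 0 := (ae_withDensity_iff hq).2 (ae_of_all _ fun x h => h)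
  have ht : ∀ᵐ x ∂μ, q x < ∞ := by
    refine ae_lt_top hq ?_
    have := measure_ne_top Q Set.univ
    rwa [hQ, withDensity_apply _ MeasurableSet.univ, Measure.restrict_univ] at this
  filter_upwards [hac.ae_le h0, hPμ.ae_le ht, hac.ae_le (Measure.rnDeriv_eq_div hPμ hQμ),
    hPμ.ae_le (Measure.rnDeriv_withDensity μ hm), hPμ.ae_le (Measure.rnDeriv_withDensity μ hq)]
    with x hx0 hxt hxr hxp hxq
  refine ⟨hx0, hxt.ne, ?_⟩
  rw [llr, hxr, hxp, hxq, ENNReal.toReal_div, ENNReal.toReal_ofReal (Real.exp_pos _).le,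
    Real.log_div (Real.exp_pos _).ne' (ENNReal.toReal_ne_zero.2 ⟨hx0, hxt.ne⟩), Real.log_exp]

section TreeDensity

variable {n : ℕ} (S : Matrix (Fin n) (Fin n) ℝ) (r : Fin n) (pa : Fin n → Fin n)

/-- The coefficient of the regression of `X_i` on its parent coordinate, set to `0` at the root. -/
def regCoef (i : Fin n) : ℝ := if i = r then 0 else S (pa i) i

/-- The residual of the regression of `X_i` on its parent coordinate. -/
def resid (i : Fin n) (x : Sample n) : ℝ := x i - regCoef S r pa i * x (pa i)

/-- The density of the projection of `N(0, S)` on the rooted tree with parent map `pa`: every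
conditional density along the tree is the one of `N(0, S)`. -/
noncomputable def treeDensity (x : Sample n) : ℝ≥0∞ :=
  ∏ i, gaussianPDF 0 (residVar (regCoef S r pa i)) (resid S r pa i x)

/-- The logarithm of `treeDensity`. -/
noncomputable def logTreeDensity (x : Sample n) : ℝ :=
  ∑ i, (-Real.log (2 * Real.pi * (1 - regCoef S r pa i ^ 2)) / 2
    - resid S r pa i x ^ 2 / (2 * (1 - regCoef S r pa i ^ 2)))

/-- The Kullback-Leibler divergence of `N(0, S)` to its projection on the rooted tree with parent
map `pa`. -/
noncomputable def treeDiv : ℝ :=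
  ∫ x, logDensity S x - logTreeDensity S r pa x ∂(multivariateGaussian 0 S)

variable {S r pa}

theorem measurable_resid (i : Fin n) : Measurable (resid S r pa i) := by
  unfold resid; fun_prop

theorem measurable_treeDensity : Measurable (treeDensity S r pa) :=
  Finset.measurable_prod _ fun i _ => (measurable_gaussianPDF _ _).comp (measurable_resid i)

theorem measurable_logDensity : Measurable (logDensity S) := by
  unfold logDensity dotProduct mulVec dotProduct
  fun_prop

theorem regCoef_sq_lt_one (hS : S.PosDef) (hd : ∀ i, S i i = 1) (hpa : ∀ i, i ≠ r → pa i ≠ i)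
    (i : Fin n) : regCoef S r pa i ^ 2 < 1 := by
  unfold regCoef
  split_ifs with h
  · norm_num
  · exact sq_entry_lt_one hS hd (hpa i h)

theorem gaussianPDF_zero_residVar {a : ℝ} (ha : a ^ 2 < 1) (z : ℝ) :
    gaussianPDF 0 (residVar a) z = ENNReal.ofReal (Real.exp
      (-Real.log (2 * Real.pi * (1 - a ^ 2)) / 2 - z ^ 2 / (2 * (1 - a ^ 2)))) := by
  rw [gaussianPDF, gaussianPDFReal, coe_residVar ha]
  congr 1
  have hp : (0 : ℝ) < 2 * Real.pi * (1 - a ^ 2) := by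
    have : 0 < 1 - a ^ 2 := by linarith
    positivity
  have hc : Real.exp (-Real.log (2 * Real.pi * (1 - a ^ 2)) / 2)
      = (√(2 * Real.pi * (1 - a ^ 2)))⁻¹ := by
    rw [Real.exp_half, Real.exp_neg, Real.exp_log hp, Real.sqrt_inv]
  rw [sub_eq_add_neg (_ / _), Real.exp_add, hc, sub_zero, neg_div]

theorem treeDensity_eq (hS : S.PosDef) (hd : ∀ i, S i i = 1) (hpa : ∀ i, i ≠ r → pa i ≠ i)
    (x : Sample n) :
    treeDensity S r pa x = ENNReal.ofReal (Real.exp (logTreeDensity S r pa x)) := by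
  rw [treeDensity, logTreeDensity, Real.exp_sum,
    ENNReal.ofReal_prod_of_nonneg fun i _ => (Real.exp_pos _).le]
  exact Finset.prod_congr rfl fun i _ =>
    gaussianPDF_zero_residVar (regCoef_sq_lt_one hS hd hpa i) _

theorem integrable_resid (i : Fin n) :
    Integrable (fun x => resid S r pa i x ^ 2) (multivariateGaussian 0 S) :=
  integrable_resid_sq _ _ _

theorem integrable_logTreeDensity :
    Integrable (logTreeDensity S r pa) (multivariateGaussian 0 S) :=
  integrable_finsetSum _ fun i _ =>
    (integrable_const _).sub ((integrable_resid i).div_const _)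

theorem integral_resid_regCoef (hS : S.PosDef) (hd : ∀ i, S i i = 1) (i : Fin n) :
    ∫ x, resid S r pa i x ^ 2 ∂(multivariateGaussian 0 S) = 1 - regCoef S r pa i ^ 2 := by
  unfold resid regCoef
  split_ifs with h
  · have := integral_coord_mul_coord hS.posSemidef i i
    rw [hd] at this
    simpa [pow_two] using this
  · exact integral_resid_sq hS hd i (pa i)

/-- The mutual information of two standard Gaussian variables with correlation `a`. -/
noncomputable def mutualInfo (a : ℝ) : ℝ := -Real.log (1 - a ^ 2) / 2

/-- The divergence to a tree projection is a constant minus the total mutual information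
along the edges of the tree. -/
theorem treeDiv_eq (hS : S.PosDef) (hd : ∀ i, S i i = 1) (hpa : ∀ i, i ≠ r → pa i ≠ i) :
    treeDiv S r pa = ∫ x, logDensity S x ∂(multivariateGaussian 0 S)
      + n * ((Real.log (2 * Real.pi) + 1) / 2)
      - ∑ i ∈ Finset.univ.erase r, mutualInfo (S (pa i) i) := by
  have hlt := regCoef_sq_lt_one hS hd hpa
  have h1 : ∫ x, logTreeDensity S r pa x ∂(multivariateGaussian 0 S)
      = ∑ i, (-((Real.log (2 * Real.pi) + 1) / 2) + mutualInfo (regCoef S r pa i)) := by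
    unfold logTreeDensity
    rw [integral_finsetSum]
    swap
    · exact fun i _ => (integrable_const _).sub ((integrable_resid i).div_const _)
    refine Finset.sum_congr rfl fun i _ => ?_
    have hv : 0 < 1 - regCoef S r pa i ^ 2 := by linarith [hlt i]
    rw [integral_sub (integrable_const _) ((integrable_resid i).div_const _), integral_const,
      integral_div,
      integral_resid_regCoef hS hd, Real.log_mul (by positivity) hv.ne', mutualInfo]
    simp
    field_simp
    ring
  have h2 : ∑ i ∈ Finset.univ.erase r, mutualInfo (S (pa i) i)
      = ∑ i, mutualInfo (regCoef S r pa i) := by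
    rw [← Finset.add_sum_erase _ _ (Finset.mem_univ r)]
    have : mutualInfo (regCoef S r pa r) = 0 := by simp [regCoef, mutualInfo]
    rw [this, zero_add]
    refine Finset.sum_congr rfl fun i hi => ?_
    rw [regCoef, if_neg (Finset.ne_of_mem_erase hi)]
  rw [treeDiv, integral_sub integrable_logDensity integrable_logTreeDensity, h1, h2,
    Finset.sum_add_distrib]
  simp
  ring

/-- Every distribution that factorizes along a rooted tree is at least as far from `N(0, S)` as
the projection of `N(0, S)` on this tree. Each factor of such a density, divided by the matching
conditional density of `N(0, S)`, has mean one under `N(0, S)`, and `log t ≤ t - 1`. -/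
theorem treeDiv_le_klDiv (hS : S.PosDef) (hd : ∀ i, S i i = 1) (hpa : ∀ i, i ≠ r → pa i ≠ i)
    (Q : ProbabilityMeasure (Sample n)) (hQ : HasTreeDensity r pa (Q : Measure (Sample n)))
    (hfin : InformationTheory.klDiv (multivariateGaussian 0 S) (Q : Measure (Sample n)) ≠ ∞) :
    treeDiv S r pa ≤
      (InformationTheory.klDiv (multivariateGaussian 0 S) (Q : Measure (Sample n))).toReal := by
  obtain ⟨f, k, hf, hf1, hk, hk1, hQd⟩ := hQ
  obtain ⟨hac, hint⟩ := InformationTheory.klDiv_ne_top_iff.1 hfin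
  rw [InformationTheory.toReal_klDiv_of_measure_eq hac (by simp), treeDiv]
  have hlt := regCoef_sq_lt_one hS hd hpa
  have hv0 : ∀ i, residVar (regCoef S r pa i) ≠ 0 := fun i => residVar_ne_zero (hlt i)
  -- the factors of the density of `Q`, one for each vertex
  let g : Fin n → Sample n → ℝ≥0∞ := fun i x => if i = r then f (x r) else k i (x (pa i)) (x i)
  have hg : ∀ i, Measurable (g i) := by
    intro i
    by_cases h : i = r
    · simp only [g, h, if_true]
      fun_prop
    · simp only [g, h, if_false]
      exact (hk i).comp (by fun_prop : Measurable fun x : Sample n => (x (pa i), x i))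
  have hgq : ∀ x : Sample n,
      f (x r) * ∏ i ∈ Finset.univ.erase r, k i (x (pa i)) (x i) = ∏ i, g i x := by
    intro x
    rw [← Finset.mul_prod_erase _ _ (Finset.mem_univ r)]
    congr 1
    · simp [g]
    · exact Finset.prod_congr rfl fun i hi => by simp [g, Finset.ne_of_mem_erase hi]
  simp_rw [hgq] at hQd
  -- the likelihood ratio of each factor
  let ρ : Fin n → Sample n → ℝ≥0∞ := fun i x =>
    g i x / gaussianPDF 0 (residVar (regCoef S r pa i)) (resid S r pa i x)
  have hρm : ∀ i, Measurable (ρ i) := fun i =>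
    (hg i).div ((measurable_gaussianPDF _ _).comp (measurable_resid i))
  have hρ1 : ∀ i, ∫⁻ x, ρ i x ∂(multivariateGaussian 0 S) = 1 := by
    intro i
    by_cases h : i = r
    · subst h
      have := lintegral_div_gaussianPDF hS hd i hf
      rw [hf1] at this
      simpa [ρ, g, resid, regCoef, residVar] using this
    · have := lintegral_div_gaussianPDF_resid hS hd (hpa i h) (hk i) (hk1 i)
      simpa [ρ, g, resid, regCoef, h] using this
  have hρint : ∀ i, Integrable (fun x => (ρ i x).toReal) (multivariateGaussian 0 S) := fun i =>
    integrable_toReal_of_lintegral_ne_top (hρm i).aemeasurable (by rw [hρ1 i]; simp)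
  have hρE : ∀ i, ∫ x, (ρ i x).toReal ∂(multivariateGaussian 0 S) = 1 := by
    intro i
    rw [integral_toReal (hρm i).aemeasurable (ae_lt_top (hρm i) (by rw [hρ1 i]; simp)), hρ1 i]
    simp
  have hgauss : ∫ x, (logDensity S x - logTreeDensity S r pa x
      + ∑ i, (1 - (ρ i x).toReal)) ∂(multivariateGaussian 0 S)
      = ∫ x, (logDensity S x - logTreeDensity S r pa x) ∂(multivariateGaussian 0 S) := by
    rw [integral_add, integral_finsetSum]
    · simp [integral_sub (integrable_const _) (hρint _), hρE]
    · exact fun i _ => (integrable_const _).sub (hρint i)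
    · exact integrable_logDensity.sub integrable_logTreeDensity
    · exact integrable_finsetSum _ fun i _ => (integrable_const _).sub (hρint i)
  rw [← hgauss]
  refine integral_mono_ae ((integrable_logDensity.sub integrable_logTreeDensity).add
    (integrable_finsetSum _ fun i _ => (integrable_const _).sub (hρint i))) hint ?_
  have hP := multivariateGaussian_eq_withDensity hS
  have hllr : ∀ᵐ x ∂(multivariateGaussian 0 S), (∏ i, g i x) ≠ 0 ∧ (∏ i, g i x) ≠ ∞ ∧
      llr (multivariateGaussian 0 S) (Q : Measure (Sample n)) x
        = logDensity S x - Real.log (∏ i, g i x).toReal := by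
    have i1 : SigmaFinite ((volume : Measure (Sample n)).withDensity
        fun x => ENNReal.ofReal (Real.exp (logDensity S x))) := by rw [← hP]; infer_instance
    have i2 : IsFiniteMeasure ((volume : Measure (Sample n)).withDensity
        fun x => ∏ i, g i x) := by rw [← hQd]; infer_instance
    rw [hP, hQd] at hac ⊢
    exact llr_ae_eq_sub measurable_logDensity
      (Finset.measurable_prod _ fun i _ => hg i) hac
  filter_upwards [hllr] with x ⟨hx0, hxt, hx⟩
  have hg0 : ∀ i, g i x ≠ 0 := fun i => Finset.prod_ne_zero_iff.1 hx0 i (Finset.mem_univ i)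
  have hgt : ∀ i, g i x ≠ ∞ := by
    intro i hi
    refine hxt ?_
    rw [← Finset.mul_prod_erase _ _ (Finset.mem_univ i), hi,
      ENNReal.top_mul (Finset.prod_ne_zero_iff.2 fun j _ => hg0 j)]
  have hlog : Real.log (∏ i, g i x).toReal
      = logTreeDensity S r pa x + ∑ i, Real.log (ρ i x).toReal := by
    have hφ : ∀ i, 0 < (gaussianPDF 0 (residVar (regCoef S r pa i)) (resid S r pa i x)).toReal :=
      fun i => ENNReal.toReal_pos (gaussianPDF_pos _ (hv0 i) _).ne' gaussianPDF_ne_top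
    rw [ENNReal.toReal_prod, Real.log_prod fun i _ => ENNReal.toReal_ne_zero.2 ⟨hg0 i, hgt i⟩,
      logTreeDensity, ← Finset.sum_add_distrib]
    refine Finset.sum_congr rfl fun i _ => ?_
    have := hφ i
    simp only [ρ]
    rw [ENNReal.toReal_div, Real.log_div (ENNReal.toReal_ne_zero.2 ⟨hg0 i, hgt i⟩) (hφ i).ne',
      gaussianPDF_zero_residVar (hlt i), ENNReal.toReal_ofReal (Real.exp_pos _).le, Real.log_exp]
    ring
  have hle : ∑ i, Real.log (ρ i x).toReal ≤ ∑ i, ((ρ i x).toReal - 1) := by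
    refine Finset.sum_le_sum fun i _ => Real.log_le_sub_one_of_pos (ENNReal.toReal_pos ?_ ?_)
    · exact (ENNReal.div_pos (hg0 i) gaussianPDF_ne_top).ne'
    · exact ENNReal.div_ne_top (hgt i) (gaussianPDF_pos _ (hv0 i) _).ne'
  rw [hx, hlog]
  have : ∑ i, (1 - (ρ i x).toReal) = - ∑ i, ((ρ i x).toReal - 1) := by
    rw [← Finset.sum_neg_distrib]; simp
  rw [this]
  linarith

/-- The divergence to the tree projection itself. -/
theorem klDiv_treeDensity (hS : S.PosDef) (hd : ∀ i, S i i = 1) (hpa : ∀ i, i ≠ r → pa i ≠ i)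
    (hQ : IsProbabilityMeasure ((volume : Measure (Sample n)).withDensity (treeDensity S r pa))) :
    InformationTheory.klDiv (multivariateGaussian 0 S)
      ((volume : Measure (Sample n)).withDensity (treeDensity S r pa))
      = ENNReal.ofReal (treeDiv S r pa) ∧ 0 ≤ treeDiv S r pa := by
  have hP := multivariateGaussian_eq_withDensity hS
  have i1 : SigmaFinite ((volume : Measure (Sample n)).withDensity
      fun x => ENNReal.ofReal (Real.exp (logDensity S x))) := by rw [← hP]; infer_instance
  have hac : multivariateGaussian 0 S
      ≪ (volume : Measure (Sample n)).withDensity (treeDensity S r pa) := by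
    have h1 : multivariateGaussian 0 S ≪ (volume : Measure (Sample n)) := by
      rw [hP]; exact withDensity_absolutelyContinuous _ _
    refine h1.trans (withDensity_absolutelyContinuous' measurable_treeDensity.aemeasurable
      (ae_of_all _ fun x => ?_))
    rw [treeDensity_eq hS hd hpa]
    simp [Real.exp_pos]
  have hllr : llr (multivariateGaussian 0 S)
      ((volume : Measure (Sample n)).withDensity (treeDensity S r pa))
      =ᵐ[multivariateGaussian 0 S] fun x => logDensity S x - logTreeDensity S r pa x := by
    have := hac
    rw [hP] at this ⊢
    filter_upwards [llr_ae_eq_sub measurable_logDensity measurable_treeDensity this]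
      with x ⟨_, _, hx⟩
    rw [hx, treeDensity_eq hS hd hpa, ENNReal.toReal_ofReal (Real.exp_pos _).le, Real.log_exp]
  have hint := (integrable_logDensity (S := S)).sub
    (integrable_logTreeDensity (S := S) (r := r) (pa := pa))
  have hint' := hint.congr hllr.symm
  constructor
  · rw [InformationTheory.klDiv_of_ac_of_integrable hac hint', integral_congr_ae hllr]
    simp [treeDiv]
  · have := InformationTheory.integral_llr_add_sub_measure_univ_nonneg hac hint'
    rw [integral_congr_ae hllr] at this
    simpa [treeDiv] using this

end TreeDensity

/-! ### Conditional independence in a linear regression -/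

section CondIndep

variable {Ω γ : Type*} [mΩ : MeasurableSpace Ω] [MeasurableSpace γ]
  {μ : Measure Ω} [IsProbabilityMeasure μ]

/-- The kernel `v ↦ law of c v + Z`, for `Z` distributed as `ν`. -/
noncomputable def shiftKernel {δ : Type*} [MeasurableSpace δ] (ν : Measure ℝ) (c : δ → ℝ) :
    Kernel δ ℝ :=
  (Kernel.id ×ₖ Kernel.const δ ν).map fun p => c p.1 + p.2

theorem map_prodMk_add_eq_compProd {δ : Type*} [MeasurableSpace δ] {V : Ω → δ} {N : Ω → ℝ}
    {c : δ → ℝ} (hV : Measurable V) (hN : Measurable N) (hc : Measurable c)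
    (h : IndepFun V N μ) :
    μ.map (fun ω => (V ω, c (V ω) + N ω)) = μ.map V ⊗ₘ shiftKernel (μ.map N) c := by
  have : IsProbabilityMeasure (μ.map N) := Measure.isProbabilityMeasure_map hN.aemeasurable
  have : IsProbabilityMeasure (μ.map V) := Measure.isProbabilityMeasure_map hV.aemeasurable
  have hg : Measurable fun p : δ × ℝ => c p.1 + p.2 := by fun_prop
  have hk : IsSFiniteKernel (shiftKernel (μ.map N) c) := by
    unfold shiftKernel; infer_instance
  refine Measure.ext_of_lintegral _ fun f hf => ?_
  have hfg : Measurable fun p : δ × ℝ => f (p.1, c p.1 + p.2) := hf.comp (by fun_prop)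
  rw [Measure.lintegral_compProd hf, lintegral_map hf (by fun_prop)]
  calc
    _ = ∫⁻ p, f (p.1, c p.1 + p.2) ∂(μ.map fun ω => (V ω, N ω)) := by
      rw [lintegral_map hfg (by fun_prop)]
    _ = ∫⁻ v, ∫⁻ z, f (v, c v + z) ∂(μ.map N) ∂(μ.map V) := by
      rw [(indepFun_iff_map_prod_eq_prod_map_map hV.aemeasurable hN.aemeasurable).1 h,
        lintegral_prod _ hfg.aemeasurable]
    _ = _ := by
      refine lintegral_congr fun v => ?_
      have hfv : Measurable fun z : ℝ => f (v, z) := hf.comp (by fun_prop)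
      have hfv' : Measurable fun p : δ × ℝ => f (v, c p.1 + p.2) := hfv.comp hg
      rw [shiftKernel, Kernel.lintegral_map _ hg _ hfv, Kernel.lintegral_id_prod hfv']
      rfl

/-- If `N` is independent of `W`, and `k` is a function of `W`, then `a k + N` is conditionally
independent of `W` given `k`: given `(k, W)` as well as given `k` alone, it is distributed as a
shift of `N` by `a k`. -/
theorem condIndepFun_of_indepFun_resid [StandardBorelSpace Ω] [StandardBorelSpace γ]
    [Nonempty γ] {N : Ω → ℝ} {W : Ω → γ}
    {φ : γ → ℝ} (a : ℝ) (hN : Measurable N) (hW : Measurable W) (hφ : Measurable φ)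
    {k X : Ω → ℝ} (hk : Measurable k) (hkW : ∀ ω, k ω = φ (W ω)) (hX : ∀ ω, X ω = a * k ω + N ω)
    (h : IndepFun W N μ) :
    CondIndepFun (MeasurableSpace.comap k inferInstance) hk.comap_le X W μ := by
  refine CondIndepFun.symm ?_
  have : IsProbabilityMeasure (μ.map N) := Measure.isProbabilityMeasure_map hN.aemeasurable
  have hXm : Measurable X := by
    rw [funext hX]; fun_prop
  refine (condIndepFun_iff_condDistrib_prod_ae_eq_prodMkRight hXm hW hk).2 ?_
  have hkφ : k = φ ∘ W := funext hkW
  have h1 : IndepFun k N μ := by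
    rw [hkφ]; exact h.comp hφ measurable_id
  have h2 : IndepFun (fun ω => (k ω, W ω)) N μ := by
    rw [hkφ]; exact h.comp (by fun_prop : Measurable fun w => (φ w, w)) measurable_id
  have f1 : IsFiniteKernel (shiftKernel (μ.map N) fun y : ℝ => a * y) := by
    have : Measurable fun p : ℝ × ℝ => a * p.1 + p.2 := by fun_prop
    unfold shiftKernel; infer_instance
  have f2 : IsFiniteKernel (shiftKernel (μ.map N) fun p : ℝ × γ => a * p.1) := by
    have : Measurable fun p : (ℝ × γ) × ℝ => a * p.1.1 + p.2 := by fun_prop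
    unfold shiftKernel; infer_instance
  have e1 : condDistrib X k μ =ᵐ[μ.map k] shiftKernel (μ.map N) fun y : ℝ => a * y := by
    refine condDistrib_ae_eq_of_measure_eq_compProd k hXm.aemeasurable ?_
    rw [← map_prodMk_add_eq_compProd hk hN (by fun_prop) h1, funext hX]
  have e2 : condDistrib X (fun ω => (k ω, W ω)) μ
      =ᵐ[μ.map fun ω => (k ω, W ω)] shiftKernel (μ.map N) fun p : ℝ × γ => a * p.1 := by
    refine condDistrib_ae_eq_of_measure_eq_compProd _ hXm.aemeasurable ?_
    rw [← map_prodMk_add_eq_compProd (hk.prodMk hW) hN (by fun_prop) h2, funext hX]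
  have e1' : ∀ᵐ p ∂(μ.map fun ω => (k ω, W ω)),
      condDistrib X k μ p.1 = shiftKernel (μ.map N) (fun y : ℝ => a * y) p.1 := by
    have e3 : ∀ᵐ y ∂((μ.map fun ω => (k ω, W ω)).map Prod.fst),
        condDistrib X k μ y = shiftKernel (μ.map N) (fun y : ℝ => a * y) y := by
      rw [Measure.map_map measurable_fst (hk.prodMk hW)]
      exact e1
    exact ae_of_ae_map measurable_fst.aemeasurable e3
  filter_upwards [e2, e1'] with p h2 h1
  rw [h2, Kernel.prodMkRight_apply, h1]
  ext s hs
  rw [shiftKernel, shiftKernel, Kernel.map_apply' _ (by fun_prop) _ hs,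
    Kernel.map_apply' _ (by fun_prop) _ hs,
    Kernel.id_prod_apply' _ _
      ((by fun_prop : Measurable fun q : (ℝ × γ) × ℝ => a * q.1.1 + q.2) hs),
    Kernel.id_prod_apply' _ _ ((by fun_prop : Measurable fun q : ℝ × ℝ => a * q.1 + q.2) hs)]
  rfl

end CondIndep

/-! ### The tree of a parent map -/

/-- `pa` is the parent map of a tree rooted at `r` in which the vertex `i` has depth `d i`. -/
structure IsParentMap {n : ℕ} (r : Fin n) (pa : Fin n → Fin n) (d : Fin n → ℕ) : Prop where
  depth_root : d r = 0
  depth_eq : ∀ i, i ≠ r → d i = d (pa i) + 1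

section ParentMap

variable {n : ℕ} {r : Fin n} {pa : Fin n → Fin n} {d : Fin n → ℕ}

/-- The graph in which every vertex other than the root is joined to its parent. -/
def parentGraph (r : Fin n) (pa : Fin n → Fin n) : SimpleGraph (Fin n) :=
  SimpleGraph.fromRel fun a b => b ≠ r ∧ a = pa b

theorem IsParentMap.pa_ne (h : IsParentMap r pa d) {i : Fin n} (hi : i ≠ r) : pa i ≠ i := by
  intro e
  have := h.depth_eq i hi
  rw [e] at this
  omega

theorem IsParentMap.adj_pa (h : IsParentMap r pa d) {i : Fin n} (hi : i ≠ r) :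
    (parentGraph r pa).Adj (pa i) i :=
  (SimpleGraph.fromRel_adj _ _ _).2 ⟨h.pa_ne hi, Or.inl ⟨hi, rfl⟩⟩

theorem IsParentMap.exists_walk (h : IsParentMap r pa d) (i : Fin n) :
    ∃ p : (parentGraph r pa).Walk r i, p.length = d i := by
  generalize hm : d i = m
  induction m generalizing i with
  | zero =>
    have : i = r := by
      by_contra hi
      have := h.depth_eq i hi
      omega
    subst this
    exact ⟨.nil, rfl⟩
  | succ m ih =>
    have hi : i ≠ r := by
      rintro rfl
      rw [h.depth_root] at hm
      omega
    obtain ⟨p, hp⟩ := ih (pa i) (by have := h.depth_eq i hi; omega)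
    exact ⟨p.concat (h.adj_pa hi), by rw [SimpleGraph.Walk.length_concat, hp]⟩

theorem IsParentMap.depth_le_of_walk (h : IsParentMap r pa d) {a b : Fin n}
    (p : (parentGraph r pa).Walk a b) : d b ≤ d a + p.length := by
  induction p with
  | nil => simp
  | @cons u v w huv p ih =>
    have : d v ≤ d u + 1 := by
      rcases ((SimpleGraph.fromRel_adj _ _ _).1 huv).2 with ⟨hv, e⟩ | ⟨hu, e⟩
      · rw [h.depth_eq v hv, e]
      · have := h.depth_eq u hu
        rw [← e] at this
        omega
    rw [SimpleGraph.Walk.length_cons]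
    omega

theorem IsParentMap.dist_eq (h : IsParentMap r pa d) (i : Fin n) :
    (parentGraph r pa).dist r i = d i := by
  obtain ⟨p, hp⟩ := h.exists_walk i
  refine le_antisymm (hp ▸ SimpleGraph.dist_le p) ?_
  obtain ⟨q, hq⟩ := p.reachable.exists_walk_length_eq_dist
  have := h.depth_le_of_walk q
  rw [h.depth_root] at this
  omega

theorem IsParentMap.arc_pa (h : IsParentMap r pa d) {i : Fin n} (hi : i ≠ r) :
    Arc (parentGraph r pa) r (pa i) i :=
  ⟨h.adj_pa hi, by rw [h.dist_eq, h.dist_eq, h.depth_eq i hi]⟩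

theorem IsParentMap.isTree (h : IsParentMap r pa d) : (parentGraph r pa).IsTree := by
  rw [SimpleGraph.isTree_iff_connected_and_card]
  have : Nonempty (Fin n) := ⟨r⟩
  refine ⟨⟨fun a b => ?_⟩, ?_⟩
  · obtain ⟨p, -⟩ := h.exists_walk a
    obtain ⟨q, -⟩ := h.exists_walk b
    exact p.reachable.symm.trans q.reachable
  · have himg : (parentGraph r pa).edgeSet = (fun i => s(pa i, i)) '' {i | i ≠ r} := by
      ext e
      induction e using Sym2.ind with
      | _ a b =>
        rw [SimpleGraph.mem_edgeSet]
        constructor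
        · intro hab
          rcases ((SimpleGraph.fromRel_adj _ _ _).1 hab).2 with ⟨hb, e⟩ | ⟨ha, e⟩
          · exact ⟨b, hb, by rw [e]⟩
          · exact ⟨a, ha, by rw [e]; exact Sym2.eq_swap⟩
        · rintro ⟨i, hi, e⟩
          have := h.adj_pa hi
          rwa [← SimpleGraph.mem_edgeSet, show s(pa i, i) = s(a, b) from e] at this
    have hinj : Set.InjOn (fun i => s(pa i, i)) {i | i ≠ r} := by
      intro i hi j hj e
      rcases Sym2.eq_iff.1 e with ⟨-, e⟩ | ⟨e1, e2⟩
      · exact e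
      · have h1 := h.depth_eq i hi
        have h2 := h.depth_eq j hj
        rw [e1] at h1
        rw [← e2] at h2
        omega
    rw [himg, Nat.card_coe_set_eq, hinj.ncard_image]
    have := Set.ncard_add_ncard_compl ({r} : Set (Fin n))
    rw [Set.ncard_singleton] at this
    rw [← this, add_comm]
    rfl

end ParentMap

/-! ### The tree projection is tree-structured -/

section Projection

variable {n : ℕ} (S : Matrix (Fin n) (Fin n) ℝ) (r : Fin n) (pa : Fin n → Fin n)
  {d : Fin n → ℕ}

/-- The matrix of the linear map that sends `x` to its vector of residuals. -/
def residMatrix : Matrix (Fin n) (Fin n) ℝ :=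
  of fun i j => (if j = i then 1 else 0) - if j = pa i then regCoef S r pa i else 0

theorem residMatrix_mulVec (x : Sample n) (i : Fin n) :
    (residMatrix S r pa *ᵥ x.ofLp) i = resid S r pa i x := by
  simp [residMatrix, mulVec, dotProduct, resid, sub_mul, ite_mul]

/-- Parents precede children in the order of depths, so the residual map is unitriangular. -/
theorem IsParentMap.det_residMatrix (h : IsParentMap r pa d) : (residMatrix S r pa).det = 1 := by
  have htri : (residMatrix S r pa).BlockTriangular fun i => OrderDual.toDual (d i) := by
    intro i j hij
    have hij : d i < d j := hij
    have hne : j ≠ i := by rintro rfl; exact lt_irrefl _ hij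
    by_cases hi : i = r
    · subst hi
      simp [residMatrix, hne, regCoef]
    · have : j ≠ pa i := by
        rintro rfl
        have := h.depth_eq i hi
        omega
      simp [residMatrix, hne, this]
  rw [htri.det]
  refine Finset.prod_eq_one fun a _ => ?_
  have : (residMatrix S r pa).toSquareBlock (fun i => OrderDual.toDual (d i)) a = 1 := by
    ext i j
    rw [toSquareBlock_def, of_apply, one_apply]
    have hd : d i.1 = d j.1 := OrderDual.toDual.injective (i.2.trans j.2.symm)
    by_cases hi : i.1 = r
    · simp [residMatrix, regCoef, hi, Subtype.ext_iff, eq_comm]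
    · have : j.1 ≠ pa i.1 := by
        intro e
        have := h.depth_eq i hi
        rw [← e] at this
        omega
      simp [residMatrix, this, Subtype.ext_iff, eq_comm]
  rw [this, det_one]

variable {S r pa}

/-- The distribution whose density is `treeDensity`. -/
noncomputable def treeMeasure (S : Matrix (Fin n) (Fin n) ℝ) (r : Fin n) (pa : Fin n → Fin n) :
    Measure (Sample n) :=
  volume.withDensity (treeDensity S r pa)

/-- Under the tree projection, the residuals are independent centred Gaussian variables. -/
theorem IsParentMap.map_resid (h : IsParentMap r pa d) (hS : S.PosDef) (hd : ∀ i, S i i = 1) :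
    (treeMeasure S r pa).map (fun x i => resid S r pa i x)
      = Measure.pi fun i => gaussianReal 0 (residVar (regCoef S r pa i)) := by
  have hu : IsUnit (residMatrix S r pa).det := by rw [h.det_residMatrix]; exact isUnit_one
  have hv0 : ∀ i, residVar (regCoef S r pa i) ≠ 0 := fun i =>
    residVar_ne_zero (regCoef_sq_lt_one hS hd (fun j hj => h.pa_ne hj) i)
  let e := (linearMeasurableEquiv (residMatrix S r pa) hu).trans
    (MeasurableEquiv.toLp 2 (Fin n → ℝ)).symm
  have he : (fun (x : Sample n) i => resid S r pa i x) = e := by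
    funext x i
    rw [← residMatrix_mulVec]
    rfl
  have hvol : (volume : Measure (Sample n)).map e = volume := by
    have h1 := map_linearMeasurableEquiv (residMatrix S r pa) hu
    rw [h.det_residMatrix] at h1
    have h2 : (volume : Measure (Sample n)).map e
        = ((volume : Measure (Sample n)).map (linearMeasurableEquiv _ hu)).map
          (MeasurableEquiv.toLp 2 (Fin n → ℝ)).symm := by
      rw [Measure.map_map (MeasurableEquiv.measurable _) (MeasurableEquiv.measurable _)]
      rfl
    rw [h2, h1]
    simp only [inv_one, abs_one, ENNReal.ofReal_one, one_smul]
    exact (PiLp.volume_preserving_ofLp (Fin n)).map_eq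
  have hσ : ∀ i, SigmaFinite ((volume : Measure ℝ).withDensity
      (gaussianPDF 0 (residVar (regCoef S r pa i)))) := fun i => by
    rw [← gaussianReal_of_var_ne_zero 0 (hv0 i)]; infer_instance
  simp_rw [fun i => gaussianReal_of_var_ne_zero 0 (hv0 i)]
  rw [he, treeMeasure, map_withDensity_equiv, hvol,
    @pi_withDensity_fin n (fun _ => ℝ) _ (fun _ => volume) _
      (fun i => gaussianPDF 0 (residVar (regCoef S r pa i))) (fun i => measurable_gaussianPDF _ _)
      hσ]
  congr 1
  funext z
  obtain ⟨x, rfl⟩ := e.surjective z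
  rw [Function.comp, e.symm_apply_apply, treeDensity, ← he]

theorem IsParentMap.isProbabilityMeasure (h : IsParentMap r pa d) (hS : S.PosDef)
    (hd : ∀ i, S i i = 1) : IsProbabilityMeasure (treeMeasure S r pa) := by
  have : IsProbabilityMeasure
      ((treeMeasure S r pa).map (fun x i => resid S r pa i x)) := by
    rw [h.map_resid hS hd]; infer_instance
  exact Measure.isProbabilityMeasure_of_map fun x i => resid S r pa i x

theorem IsParentMap.iIndepFun_resid (h : IsParentMap r pa d) (hS : S.PosDef)
    (hd : ∀ i, S i i = 1) : iIndepFun (fun i => resid S r pa i) (treeMeasure S r pa) := by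
  have := h.isProbabilityMeasure hS hd
  have hm : Measurable fun (x : Sample n) i => resid S r pa i x :=
    measurable_pi_lambda _ fun i => measurable_resid i
  rw [iIndepFun_iff_map_fun_eq_pi_map fun i => (measurable_resid i).aemeasurable,
    h.map_resid hS hd]
  congr 1
  funext i
  have : (treeMeasure S r pa).map (resid S r pa i)
      = ((treeMeasure S r pa).map (fun x i => resid S r pa i x)).map (Function.eval i) := by
    rw [Measure.map_map (measurable_pi_apply i) hm]
    rfl
  rw [this, h.map_resid hS hd, Measure.pi_map_eval]
  simp

/-- A coordinate at a vertex that is not reachable from `i` is a function of the residuals at the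
vertices other than `i`. -/
theorem IsParentMap.exists_eq_resid (h : IsParentMap r pa d) (S : Matrix (Fin n) (Fin n) ℝ)
    {i : Fin n} (hi : i ≠ r) {j : Fin n} (hj : j ∈ nonDesc (parentGraph r pa) r i) :
    ∃ H : ((l : (Finset.univ.erase i : Finset (Fin n))) → ℝ) → ℝ, Measurable H ∧
      ∀ x : Sample n, x j = H fun l => resid S r pa l x := by
  generalize hm : d j = m
  induction m generalizing j with
  | zero =>
    have hjr : j = r := by
      by_contra hjr
      have := h.depth_eq j hjr
      omega
    subst hjr
    refine ⟨fun u => u ⟨j, by simpa using hi.symm⟩, measurable_pi_apply _, fun x => ?_⟩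
    simp [resid, regCoef]
  | succ m ih =>
    have hjr : j ≠ r := by
      rintro rfl
      rw [h.depth_root] at hm
      omega
    have hji : j ≠ i := by
      rintro rfl
      exact hj Relation.ReflTransGen.refl
    have hpj : pa j ∈ nonDesc (parentGraph r pa) r i := fun hp => hj (hp.tail (h.arc_pa hjr))
    obtain ⟨H, hH, hHx⟩ := ih hpj (by have := h.depth_eq j hjr; omega)
    refine ⟨fun u => u ⟨j, by simpa using hji⟩ + regCoef S r pa j * H u,
      (measurable_pi_apply _).add (hH.const_mul _), fun x => ?_⟩
    simp only
    rw [← hHx x, resid]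
    ring

theorem IsParentMap.markovProperty (h : IsParentMap r pa d) (hS : S.PosDef) (hd : ∀ i, S i i = 1)
    [IsFiniteMeasure (treeMeasure S r pa)] :
    MarkovProperty (parentGraph r pa) r pa (treeMeasure S r pa) := by
  intro i hi
  have := h.isProbabilityMeasure hS hd
  choose H hH hHx using fun j : nonDesc (parentGraph r pa) r i => h.exists_eq_resid S hi j.2
  have hind : IndepFun (fun (x : Sample n) (j : nonDesc (parentGraph r pa) r i) => x j.1)
      (resid S r pa i) (treeMeasure S r pa) := by
    have h1 := (h.iIndepFun_resid hS hd).indepFun_finset (Finset.univ.erase i) {i}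
      (by simp) fun i => measurable_resid i
    have m1 : Measurable fun (u : ↥(Finset.univ.erase i) → ℝ)
        (j : nonDesc (parentGraph r pa) r i) => H j u := measurable_pi_lambda _ fun j => hH j
    have m2 : Measurable fun u : ({i} : Finset (Fin n)) → ℝ => u ⟨i, by simp⟩ :=
      measurable_pi_apply _
    have h2 := h1.comp m1 m2
    convert! h2 using 1
    funext x j
    exact hHx j x
  have hpi : pa i ∈ nonDesc (parentGraph r pa) r i := by
    have hmono : ∀ a b, Relation.ReflTransGen (Arc (parentGraph r pa) r) a b → d a ≤ d b := by
      intro a b hab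
      induction hab with
      | refl => exact le_rfl
      | tail _ hbc ih =>
        have := hbc.2
        rw [h.dist_eq, h.dist_eq] at this
        omega
    intro hr
    have h1 := hmono _ _ hr
    have h2 := h.depth_eq i hi
    omega
  exact condIndepFun_of_indepFun_resid (regCoef S r pa i) (measurable_resid i)
    (measurable_pi_lambda _ fun j => by fun_prop)
    (measurable_pi_apply (⟨pa i, hpi⟩ : nonDesc (parentGraph r pa) r i)) (by fun_prop)
    (fun _ => rfl) (fun x => by rw [resid]; ring) hind

theorem IsParentMap.hasTreeDensity (h : IsParentMap r pa d) (hS : S.PosDef)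
    (hd : ∀ i, S i i = 1) : HasTreeDensity r pa (treeMeasure S r pa) := by
  have hv0 : ∀ i, residVar (regCoef S r pa i) ≠ 0 := fun i =>
    residVar_ne_zero (regCoef_sq_lt_one hS hd (fun j hj => h.pa_ne hj) i)
  refine ⟨gaussianPDF 0 1, fun i y z =>
    gaussianPDF 0 (residVar (regCoef S r pa i)) (z - regCoef S r pa i * y),
    measurable_gaussianPDF 0 1, lintegral_gaussianPDF_eq_one 0 one_ne_zero, fun i =>
    (measurable_gaussianPDF _ _).comp
      (by fun_prop : Measurable fun p : ℝ × ℝ => p.2 - regCoef S r pa i * p.1), fun i y => ?_, ?_⟩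
  · rw [lintegral_sub_right_eq_self (gaussianPDF 0 (residVar (regCoef S r pa i)))]
    exact lintegral_gaussianPDF_eq_one 0 (hv0 i)
  · rw [treeMeasure]
    congr 1
    funext x
    rw [treeDensity, ← Finset.mul_prod_erase _ _ (Finset.mem_univ r)]
    congr 1
    simp [resid, regCoef, residVar]

/-- The projection attains the bound of `treeDiv_le_klDiv`. -/
theorem IsParentMap.optTreeDiv_le (h : IsParentMap r pa d) (hS : S.PosDef)
    (hd : ∀ i, S i i = 1) :
    optTreeDiv (multivariateGaussian 0 S) ≤ ENNReal.ofReal (treeDiv S r pa)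
      ∧ 0 ≤ treeDiv S r pa := by
  have hp := h.isProbabilityMeasure hS hd
  obtain ⟨hkl, h0⟩ := klDiv_treeDensity hS hd (fun i hi => h.pa_ne hi) hp
  refine ⟨?_, h0⟩
  rw [← hkl]
  exact iInf₂_le_of_le (parentGraph r pa) h.isTree (iInf₂_le_of_le
    (⟨treeMeasure S r pa, hp⟩ : ProbabilityMeasure (Sample n))
    ⟨r, pa, fun i hi => h.arc_pa hi, h.markovProperty hS hd, h.hasTreeDensity hS hd⟩ le_rfl)

/-- The edges of an approximate tree carry at least the total mutual information of the edges of
any other tree, up to the approximation error. -/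
theorem IsApproxTree.exists_le_sum_mutualInfo {T : SimpleGraph (Fin n)} {η : ℝ} (hη : 0 ≤ η)
    (hS : S.PosDef) (hd : ∀ i, S i i = 1)
    (hT : IsApproxTree (multivariateGaussian 0 S) η T) :
    ∃ (r' : Fin n) (pa' : Fin n → Fin n), (∀ i, i ≠ r' → Arc T r' (pa' i) i) ∧
      ∀ (r : Fin n) (pa : Fin n → Fin n) (d : Fin n → ℕ), IsParentMap r pa d →
        ∑ i ∈ Finset.univ.erase r, mutualInfo (S (pa i) i)
          ≤ η + ∑ i ∈ Finset.univ.erase r', mutualInfo (S (pa' i) i) := by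
  obtain ⟨-, Q, ⟨r', pa', harc, -, hden⟩, hkl⟩ := hT
  refine ⟨r', pa', harc, fun r pa d h => ?_⟩
  have hpa' : ∀ i, i ≠ r' → pa' i ≠ i := fun i hi => (harc i hi).1.ne
  obtain ⟨hopt, h0⟩ := h.optTreeDiv_le hS hd
  have hle : InformationTheory.klDiv (multivariateGaussian 0 S) (Q : Measure (Sample n))
      ≤ ENNReal.ofReal (η + treeDiv S r pa) := by
    rw [ENNReal.ofReal_add hη h0]
    exact hkl.trans (by gcongr)
  have h1 := treeDiv_le_klDiv hS hd hpa' Q hden (hle.trans_lt ENNReal.ofReal_lt_top).ne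
  have h2 := ENNReal.toReal_le_of_le_ofReal (by positivity) hle
  rw [treeDiv_eq hS hd hpa'] at h1
  rw [treeDiv_eq hS hd fun i hi => h.pa_ne hi] at h2
  linarith

end Projection

/-! ### Testing between two hypotheses -/

section Testing

/-- A pointwise lower bound for the two errors of a test `s`, by terms whose means under the first
hypothesis are known: the mean of `u` is the divergence and that of `exp (-u)` is one. -/
theorem testing_pointwise {s u : ℝ} (h0 : 0 ≤ s) (h1 : s ≤ 1) :
    4 / 3 * (1 - u / 2) - (1 + Real.exp (-u)) / 3 ≤ s + (1 - s) * Real.exp (-u) := by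
  have hv : Real.exp (-u) = Real.exp (-u / 2) ^ 2 := by
    rw [← Real.exp_nat_mul]; congr 1; push_cast; ring
  have h2 : 1 - u / 2 ≤ Real.exp (-u / 2) := by linarith [Real.add_one_le_exp (-u / 2)]
  rw [hv]
  set v := Real.exp (-u / 2)
  -- `1` and `v²` both exceed `(4 v - 1 - v²) / 3`, by `(v - 2)² / 3` and by `(2 v - 1)² / 3`
  nlinarith [mul_nonneg h0 (sq_nonneg (v - 2)), mul_nonneg (sub_nonneg.2 h1)
    (sq_nonneg (2 * v - 1))]

variable {α : Type*} [MeasurableSpace α]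

/-- For laws `P` and `P' = exp (-u) P`, the two error probabilities of a test add up to at least
`2/3 (1 - KL(P ‖ P'))`. -/
theorem testing_error_ge {P P' : Measure α} [IsProbabilityMeasure P] [IsProbabilityMeasure P']
    {u : α → ℝ} (hu : Measurable u) (hui : Integrable u P)
    (hP' : P' = P.withDensity fun x => ENNReal.ofReal (Real.exp (-u x)))
    {s : α → ℝ} (hs : Measurable s) (h0 : ∀ x, 0 ≤ s x) (h1 : ∀ x, s x ≤ 1) :
    2 / 3 * (1 - ∫ x, u x ∂P) ≤ ∫ x, s x ∂P + ∫ x, (1 - s x) ∂P' := by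
  have hm : Measurable fun x => ENNReal.ofReal (Real.exp (-u x)) := by fun_prop
  have hE : ∫⁻ x, ENNReal.ofReal (Real.exp (-u x)) ∂P = 1 := by
    have := measure_univ (μ := P')
    rwa [hP', withDensity_apply _ MeasurableSet.univ, Measure.restrict_univ] at this
  have hei : Integrable (fun x => Real.exp (-u x)) P := by
    refine ⟨by fun_prop, ?_⟩
    rw [hasFiniteIntegral_iff_ofReal (ae_of_all _ fun x => (Real.exp_pos _).le), hE]
    simp
  have hEr : ∫ x, Real.exp (-u x) ∂P = 1 := by
    rw [integral_eq_lintegral_of_nonneg_ae (ae_of_all _ fun x => (Real.exp_pos _).le)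
      (by fun_prop), hE]
    simp
  have hsi : Integrable s P := Integrable.of_bound (by fun_prop) 1 (ae_of_all _ fun x => by
    rw [Real.norm_eq_abs, abs_le]; constructor <;> linarith [h0 x, h1 x])
  have hse : Integrable (fun x => (1 - s x) * Real.exp (-u x)) P :=
    hei.bdd_mul (c := 1) (by fun_prop) (ae_of_all _ fun x => by
      rw [Real.norm_eq_abs, abs_le]; constructor <;> linarith [h0 x, h1 x])
  have h2 : ∫ x, (1 - s x) ∂P' = ∫ x, (1 - s x) * Real.exp (-u x) ∂P := by
    rw [hP', integral_withDensity_eq_integral_toReal_smul hm (ae_of_all _ fun x => by simp)]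
    refine integral_congr_ae (ae_of_all _ fun x => ?_)
    simp [ENNReal.toReal_ofReal (Real.exp_pos _).le, mul_comm]
  have i1 : Integrable (fun x => 4 / 3 * (1 - u x / 2)) P :=
    ((integrable_const _).sub (hui.div_const 2)).const_mul _
  have i2 : Integrable (fun x => (1 + Real.exp (-u x)) / 3) P :=
    ((integrable_const _).add hei).div_const 3
  rw [h2, ← integral_add hsi hse]
  calc
    _ = ∫ x, (4 / 3 * (1 - u x / 2) - (1 + Real.exp (-u x)) / 3) ∂P := by
      rw [integral_sub i1 i2, integral_const_mul, integral_sub (integrable_const _)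
        (hui.div_const 2), integral_div, integral_div, integral_add (integrable_const _) hei, hEr]
      simp
      ring
    _ ≤ _ := integral_mono (i1.sub i2) (hsi.add hse) fun x => testing_pointwise (h0 x) (h1 x)

/-- The two error probabilities of a randomized test that uses `m` independent samples. -/
theorem kernel_testing_error_ge {P P' : Measure α} [IsProbabilityMeasure P]
    [IsProbabilityMeasure P'] {u : α → ℝ} (hu : Measurable u) (hui : Integrable u P)
    (hP' : P' = P.withDensity fun x => ENNReal.ofReal (Real.exp (-u x)))
    {β : Type*} [MeasurableSpace β] {m : ℕ} (A : Kernel (Fin m → α) β) [IsMarkovKernel A]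
    {s : Set β} (hs : MeasurableSet s) :
    2 / 3 * (1 - m * ∫ x, u x ∂P)
      ≤ ((Measure.pi fun _ : Fin m => P).bind A).real s
        + ((Measure.pi fun _ : Fin m => P').bind A).real sᶜ := by
  have hm : Measurable fun x => ENNReal.ofReal (Real.exp (-u x)) := by fun_prop
  have hui' : ∀ i : Fin m, Integrable (fun x : Fin m → α => u (x i)) (Measure.pi fun _ => P) :=
    fun i => integrable_comp_eval (μ := fun _ : Fin m => P) (i := i) hui
  have hpi : (Measure.pi fun _ : Fin m => P') = (Measure.pi fun _ : Fin m => P).withDensity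
      fun x => ENNReal.ofReal (Real.exp (-∑ i, u (x i))) := by
    have : ∀ _ : Fin m, SigmaFinite (P.withDensity fun x => ENNReal.ofReal (Real.exp (-u x))) := by
      intro; rw [← hP']; infer_instance
    have h := pi_withDensity_fin (fun _ : Fin m => P)
      (fun _ x => ENNReal.ofReal (Real.exp (-u x))) fun _ => hm
    rw [hP', h]
    congr 1
    funext x
    rw [← Finset.sum_neg_distrib, Real.exp_sum,
      ENNReal.ofReal_prod_of_nonneg fun i _ => (Real.exp_pos _).le]
  have hint : ∫ x : Fin m → α, ∑ i, u (x i) ∂(Measure.pi fun _ => P) = m * ∫ x, u x ∂P := by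
    rw [integral_finsetSum _ fun i _ => hui' i]
    have : ∀ i : Fin m, ∫ x : Fin m → α, u (x i) ∂(Measure.pi fun _ => P) = ∫ x, u x ∂P :=
      fun i => integral_comp_eval (μ := fun _ : Fin m => P) (i := i) hui.aestronglyMeasurable
    simp [this]
  have hbind : ∀ (μ : Measure (Fin m → α)) [IsProbabilityMeasure μ] {s : Set β},
      MeasurableSet s → (μ.bind A).real s = ∫ x, (A x).real s ∂μ := by
    intro μ _ s hs
    rw [measureReal_def, Measure.bind_apply hs A.measurable.aemeasurable]
    exact (integral_toReal (A.measurable_coe hs).aemeasurable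
      (ae_of_all _ fun x => measure_lt_top _ _)).symm
  have key := testing_error_ge (P := Measure.pi fun _ : Fin m => P)
    (P' := Measure.pi fun _ : Fin m => P') (u := fun x => ∑ i, u (x i)) (by fun_prop)
    (integrable_finsetSum _ fun i _ => hui' i) hpi (s := fun x => (A x).real s)
    (A.measurable_coe hs).ennreal_toReal (fun x => measureReal_nonneg)
    fun x => measureReal_le_one
  rw [hint] at key
  rw [hbind _ hs, hbind _ hs.compl]
  refine key.trans_eq ?_
  congr 2
  funext x
  rw [probReal_compl_eq_one_sub hs]

end Testing

/-! ### The likelihood ratio of two Gaussian laws -/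

section TwoGaussians

variable {n : ℕ} {S S' K : Matrix (Fin n) (Fin n) ℝ}

/-- The likelihood ratio of two Gaussian laws with the same determinant, whose precision matrices
differ by `K`. -/
theorem multivariateGaussian_eq_withDensity_exp (hS : S.PosDef) (hS' : S'.PosDef)
    (hdet : S'.det = S.det) (hK : S'⁻¹ = S⁻¹ + K) :
    multivariateGaussian 0 S' = (multivariateGaussian 0 S).withDensity
      fun x => ENNReal.ofReal (Real.exp (-((x.ofLp ⬝ᵥ K *ᵥ x.ofLp) / 2))) := by
  have hm : Measurable fun x : Sample n =>
      ENNReal.ofReal (Real.exp (-((x.ofLp ⬝ᵥ K *ᵥ x.ofLp) / 2))) := by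
    unfold dotProduct mulVec dotProduct
    fun_prop
  rw [multivariateGaussian_eq_withDensity hS, multivariateGaussian_eq_withDensity hS',
    ← withDensity_mul _ (measurable_logDensity.exp.ennreal_ofReal) hm]
  congr 1
  funext x
  rw [Pi.mul_apply, ← ENNReal.ofReal_mul (Real.exp_pos _).le, ← Real.exp_add]
  congr 2
  rw [logDensity, logDensity, hK, hdet, add_mulVec, dotProduct_add]
  ring

theorem integrable_quadratic (K : Matrix (Fin n) (Fin n) ℝ) :
    Integrable (fun x : Sample n => x.ofLp ⬝ᵥ K *ᵥ x.ofLp) (multivariateGaussian 0 S) := by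
  unfold dotProduct mulVec dotProduct
  simp_rw [Finset.mul_sum]
  refine integrable_finsetSum _ fun i _ => integrable_finsetSum _ fun j _ => ?_
  convert! (integrable_coord_mul_coord (S := S) i j).const_mul (K i j) using 2
  ring

theorem integral_quadratic (hS : S.PosDef) (K : Matrix (Fin n) (Fin n) ℝ) :
    ∫ x : Sample n, x.ofLp ⬝ᵥ K *ᵥ x.ofLp ∂(multivariateGaussian 0 S)
      = ∑ i, ∑ j, K i j * S i j := by
  have h : ∀ i j, Integrable (fun x : Sample n => x i * (K i j * x j))
      (multivariateGaussian 0 S) := by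
    intro i j
    convert! (integrable_coord_mul_coord (S := S) i j).const_mul (K i j) using 2
    ring
  unfold dotProduct mulVec dotProduct
  simp_rw [Finset.mul_sum]
  rw [integral_finsetSum _ fun i _ => integrable_finsetSum _ fun j _ => h i j]
  refine Finset.sum_congr rfl fun i _ => ?_
  rw [integral_finsetSum _ fun j _ => h i j]
  refine Finset.sum_congr rfl fun j _ => ?_
  rw [← integral_coord_mul_coord hS.posSemidef i j, ← integral_const_mul]
  congr 1
  funext x
  ring

end TwoGaussians

/-! ### Diagonally dominant correlation matrices -/

section PosDef

/-- A symmetric strictly diagonally dominant matrix with unit diagonal is positive definite. -/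
theorem posDef_of_sum_abs_lt_one {ι : Type*} [Fintype ι] [DecidableEq ι] {S : Matrix ι ι ℝ}
    (hsym : ∀ i j, S j i = S i j) (hd : ∀ i, S i i = 1)
    (hrow : ∀ i, ∑ j ∈ Finset.univ.erase i, |S i j| < 1) : S.PosDef := by
  refine PosDef.of_dotProduct_mulVec_pos (by ext i j; simp [hsym]) fun x hx => ?_
  have hexp : star x ⬝ᵥ S *ᵥ x
      = ∑ i, (x i ^ 2 + ∑ j ∈ Finset.univ.erase i, S i j * (x i * x j)) := by
    simp only [dotProduct, mulVec, Finset.mul_sum, Pi.star_apply, star_trivial]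
    refine Finset.sum_congr rfl fun i _ => ?_
    rw [← Finset.add_sum_erase _ _ (Finset.mem_univ i), hd]
    congr 1
    · ring
    · exact Finset.sum_congr rfl fun j _ => by ring
  have hcol : ∑ i, ∑ j ∈ Finset.univ.erase i, |S i j| * x j ^ 2
      = ∑ i, ∑ j ∈ Finset.univ.erase i, |S i j| * x i ^ 2 := by
    rw [Finset.sum_comm' (t' := Finset.univ) (s' := fun j => Finset.univ.erase j)
      (by simp [eq_comm])]
    refine Finset.sum_congr rfl fun i _ => Finset.sum_congr rfl fun j _ => ?_
    rw [hsym]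
  have hlow : ∑ i, (1 - ∑ j ∈ Finset.univ.erase i, |S i j|) * x i ^ 2 ≤ star x ⬝ᵥ S *ᵥ x := by
    calc
      _ = ∑ i, (x i ^ 2 - ∑ j ∈ Finset.univ.erase i, |S i j| * x i ^ 2 / 2
            - ∑ j ∈ Finset.univ.erase i, |S i j| * x j ^ 2 / 2) := by
        simp_rw [← Finset.sum_div]
        rw [Finset.sum_sub_distrib (f := fun i => x i ^ 2 - _), ← Finset.sum_div _ _ (2 : ℝ), hcol,
          Finset.sum_div, ← Finset.sum_sub_distrib]
        refine Finset.sum_congr rfl fun i _ => ?_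
        rw [← Finset.sum_mul]
        ring
      _ ≤ _ := by
        rw [hexp]
        refine Finset.sum_le_sum fun i _ => ?_
        rw [sub_sub, ← Finset.sum_add_distrib, sub_eq_add_neg, ← Finset.sum_neg_distrib]
        gcongr with j _
        have h1 : |S i j * (x i * x j)| ≤ |S i j| * x i ^ 2 / 2 + |S i j| * x j ^ 2 / 2 := by
          rw [abs_mul, abs_mul]
          have h2 := mul_nonneg (abs_nonneg (S i j)) (sq_nonneg (|x i| - |x j|))
          rw [sub_sq, sq_abs, sq_abs] at h2
          linarith
        linarith [neg_abs_le (S i j * (x i * x j))]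
  refine lt_of_lt_of_le ?_ hlow
  obtain ⟨i, hi⟩ : ∃ i, x i ≠ 0 := by
    by_contra! h
    exact hx (funext h)
  refine Finset.sum_pos' (fun j _ => ?_) ⟨i, Finset.mem_univ i, ?_⟩
  · exact mul_nonneg (by linarith [hrow j]) (sq_nonneg _)
  · exact mul_pos (by linarith [hrow i]) (by positivity)

end PosDef

/-! ### Two Gaussian laws that differ in three coordinates -/

section Swap

variable {n : ℕ}

/-- `S` and `S'` agree and are uncorrelated with the rest on three coordinates `v 0`, `v 1`, `v 2`,
where two of the three correlations are `a` and the third one is `b`; the vertex shared by the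
two pairs of correlation `a` is `v 0` for `S` and `v 1` for `S'`. -/
structure IsSwapPair (S S' : Matrix (Fin n) (Fin n) ℝ) (v : Fin 3 → Fin n) (a b : ℝ) : Prop where
  inj : Function.Injective v
  block : ∀ i j, S (v i) (v j) = !![1, a, a; a, 1, b; a, b, 1] i j
  block' : ∀ i j, S' (v i) (v j) = !![1, a, b; a, 1, a; b, a, 1] i j
  left : ∀ i j, i ∉ Set.range v → S i (v j) = 0
  right : ∀ i j, j ∉ Set.range v → S (v i) j = 0
  left' : ∀ i j, i ∉ Set.range v → S' i (v j) = 0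
  right' : ∀ i j, j ∉ Set.range v → S' (v i) j = 0
  agree : ∀ i j, i ∉ Set.range v → j ∉ Set.range v → S i j = S' i j

variable {S S' : Matrix (Fin n) (Fin n) ℝ} {v : Fin 3 → Fin n} {a b : ℝ}

/-- The determinant of the three-dimensional blocks of an `IsSwapPair`. -/
def blockDet (a b : ℝ) : ℝ := 1 + 2 * a ^ 2 * b - 2 * a ^ 2 - b ^ 2

/-- The difference of the precision matrices of an `IsSwapPair`. -/
noncomputable def precisionDiff (v : Fin 3 → Fin n) (a b : ℝ) : Matrix (Fin n) (Fin n) ℝ :=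
  ((a - b) / blockDet a b) •
    ((a + b) • (single (v 1) (v 1) 1 - single (v 0) (v 0) 1)
      + (1 + a) • (single (v 0) (v 2) 1 + single (v 2) (v 0) 1
          - single (v 1) (v 2) 1 - single (v 2) (v 1) 1))

/-- The two matrices differ by the transposition of `v 0` and `v 1`. -/
theorem IsSwapPair.det_eq (h : IsSwapPair S S' v a b) : S'.det = S.det := by
  have h01 : v 0 ≠ v 1 := h.inj.ne (by decide)
  have h02 : v 0 ≠ v 2 := h.inj.ne (by decide)
  have h12 : v 1 ≠ v 2 := h.inj.ne (by decide)
  have : S' = S.submatrix (Equiv.swap (v 0) (v 1)) (Equiv.swap (v 0) (v 1)) := by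
    have hout : ∀ i, i ∉ Set.range v → Equiv.swap (v 0) (v 1) i = i := fun i hi =>
      Equiv.swap_apply_of_ne_of_ne (fun e => hi ⟨0, e.symm⟩) fun e => hi ⟨1, e.symm⟩
    have hin : ∀ j, Equiv.swap (v 0) (v 1) (v j) = v (Equiv.swap 0 1 j) := by
      intro j
      fin_cases j
      · simp
      · simp
      · have : Equiv.swap (0 : Fin 3) 1 2 = 2 := by decide
        simp [Equiv.swap_apply_of_ne_of_ne h02.symm h12.symm, this]
    ext i j
    rw [submatrix_apply]
    by_cases hi : i ∈ Set.range v
    · obtain ⟨i, rfl⟩ := hi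
      by_cases hj : j ∈ Set.range v
      · obtain ⟨j, rfl⟩ := hj
        rw [hin, hin, h.block, h.block']
        have e0 : Equiv.swap (0 : Fin 3) 1 2 = 2 := by decide
        fin_cases i <;> fin_cases j <;> simp [e0]
      · rw [hin, hout j hj, h.right' _ _ hj, h.right _ _ hj]
    · by_cases hj : j ∈ Set.range v
      · obtain ⟨j, rfl⟩ := hj
        rw [hin, hout i hi, h.left' _ _ hi, h.left _ _ hi]
      · rw [hout i hi, hout j hj, h.agree i j hi hj]
  rw [this, det_submatrix_equiv_self]

/-- The inverses of `S` and `S'` are not needed to identify their difference: multiplied by `S'` and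
`S`, the claim `S'⁻¹ - S⁻¹ = precisionDiff v a b` can be checked entry by entry. -/
theorem IsSwapPair.mul_precisionDiff_mul (h : IsSwapPair S S' v a b) (hD : blockDet a b ≠ 0) :
    S' * precisionDiff v a b * S = S - S' := by
  have hs : ∀ p q : Fin 3, S' * single (v p) (v q) (1 : ℝ) * S
      = of fun i j => S' i (v p) * S (v q) j := by
    intro p q
    ext i j
    rw [mul_apply, Finset.sum_eq_single (v q)]
    · simp
    · intro l _ hl
      rw [mul_single_apply_of_ne _ _ _ _ _ hl, zero_mul]
    · simp
  simp only [precisionDiff, mul_smul_comm, smul_mul_assoc, Matrix.mul_add, Matrix.mul_sub,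
    Matrix.add_mul, Matrix.sub_mul, hs]
  ext i j
  simp only [Matrix.smul_apply, Matrix.add_apply, Matrix.sub_apply, of_apply, smul_eq_mul]
  by_cases hi : i ∈ Set.range v
  · obtain ⟨i, rfl⟩ := hi
    by_cases hj : j ∈ Set.range v
    · obtain ⟨j, rfl⟩ := hj
      simp only [h.block, h.block']
      rw [div_mul_eq_mul_div, div_eq_iff hD, blockDet]
      fin_cases i <;> fin_cases j <;>
        simp [-mul_eq_zero, -zero_eq_mul, -mul_eq_mul_left_iff] <;> ring
    · simp [h.right _ _ hj, h.right' _ _ hj]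
  · by_cases hj : j ∈ Set.range v
    · obtain ⟨j, rfl⟩ := hj
      simp [h.left _ _ hi, h.left' _ _ hi]
    · have : ∀ p, S' i (v p) = 0 := fun p => h.left' _ _ hi
      simp [this, h.agree i j hi hj]

theorem IsSwapPair.inv_eq (h : IsSwapPair S S' v a b) (hD : blockDet a b ≠ 0) (hS : S.PosDef) :
    S'⁻¹ = S⁻¹ + precisionDiff v a b := by
  have hu : IsUnit S.det := hS.det_pos.ne'.isUnit
  refine inv_eq_right_inv ?_
  have h1 : S' * (S⁻¹ + precisionDiff v a b) * S = S := by
    rw [Matrix.mul_add, Matrix.add_mul, h.mul_precisionDiff_mul hD, Matrix.mul_assoc,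
      nonsing_inv_mul _ hu, Matrix.mul_one, add_sub_cancel]
  calc
    _ = S' * (S⁻¹ + precisionDiff v a b) * S * S⁻¹ := by
      rw [Matrix.mul_assoc _ S, mul_nonsing_inv _ hu, Matrix.mul_one]
    _ = 1 := by rw [h1, mul_nonsing_inv _ hu]

/-- The sum of the error probabilities of a randomized test between the Gaussian laws of an
`IsSwapPair`, whose divergence is `(a - b)² (1 + a) / blockDet a b`. -/
theorem IsSwapPair.testing_error_ge (h : IsSwapPair S S' v a b) (hD : blockDet a b ≠ 0)
    (hS : S.PosDef) (hS' : S'.PosDef) {β : Type*} [MeasurableSpace β] {m : ℕ}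
    (A : Kernel (Fin m → Sample n) β) [IsMarkovKernel A] {s : Set β} (hs : MeasurableSet s) :
    2 / 3 * (1 - m * ((a - b) ^ 2 * (1 + a) / blockDet a b))
      ≤ ((Measure.pi fun _ : Fin m => multivariateGaussian 0 S).bind A).real s
        + ((Measure.pi fun _ : Fin m => multivariateGaussian 0 S').bind A).real sᶜ := by
  set K := precisionDiff v a b with hK
  have hm : Measurable fun x : Sample n => (x.ofLp ⬝ᵥ K *ᵥ x.ofLp) / 2 := by
    unfold dotProduct mulVec dotProduct
    fun_prop
  have key := kernel_testing_error_ge hm ((integrable_quadratic K).div_const 2)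
    (multivariateGaussian_eq_withDensity_exp hS hS' h.det_eq (h.inv_eq hD hS)) A hs
  have hKS : ∑ i, ∑ j, K i j * S i j = 2 * ((a - b) ^ 2 * (1 + a) / blockDet a b) := by
    have hs1 : ∀ p q : Fin 3, ∑ i, ∑ j, single (v p) (v q) (1 : ℝ) i j * S i j = S (v p) (v q) := by
      intro p q
      rw [Finset.sum_eq_single (v p), Finset.sum_eq_single (v q)]
      · simp
      · intro j _ hj
        simp [hj.symm]
      · simp
      · intro i _ hi
        simp [hi.symm]
      · simp
    simp only [hK, precisionDiff, Matrix.smul_apply, Matrix.add_apply, Matrix.sub_apply,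
      smul_eq_mul, mul_assoc, add_mul, sub_mul, ← Finset.mul_sum, Finset.sum_add_distrib,
      Finset.sum_sub_distrib, mul_add, mul_sub, hs1, h.block]
    simp
    field_simp
    ring
  rw [integral_div, integral_quadratic hS, hKS] at key
  convert! key using 4
  ring

end Swap

/-! ### The mutual information of two Gaussian variables -/

theorem mutualInfo_mono {a b : ℝ} (hb : 0 ≤ b) (hba : b ≤ a) (ha : a < 1) :
    mutualInfo b ≤ mutualInfo a := by
  unfold mutualInfo
  have h1 : 0 < 1 - a ^ 2 := by nlinarith
  have h2 : 1 - a ^ 2 ≤ 1 - b ^ 2 := by nlinarith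
  linarith [Real.log_le_log h1 h2]

theorem mutualInfo_zero : mutualInfo 0 = 0 := by simp [mutualInfo]

theorem mutualInfo_nonneg {a : ℝ} (h0 : 0 ≤ a) (ha : a < 1) : 0 ≤ mutualInfo a :=
  mutualInfo_zero ▸ mutualInfo_mono le_rfl h0 ha

/-- The mutual information varies linearly in the correlation, away from correlation `0`. -/
theorem mutualInfo_sub_ge {a b : ℝ} (hb : 0 ≤ b) (hba : b ≤ a) (ha : a < 1) :
    (a - b) * (a + b) / 2 ≤ mutualInfo a - mutualInfo b := by
  unfold mutualInfo
  have h1 : 0 < 1 - a ^ 2 := by nlinarith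
  have h2 : 0 < 1 - b ^ 2 := by nlinarith
  have h3 : Real.log ((1 - a ^ 2) / (1 - b ^ 2)) ≤ (1 - a ^ 2) / (1 - b ^ 2) - 1 :=
    Real.log_le_sub_one_of_pos (by positivity)
  rw [Real.log_div h1.ne' h2.ne'] at h3
  have h4 : (a - b) * (a + b) ≤ 1 - (1 - a ^ 2) / (1 - b ^ 2) := by
    rw [le_sub_iff_add_le, ← le_sub_iff_add_le', div_le_iff₀ h2]
    nlinarith [mul_nonneg (mul_nonneg (sub_nonneg.2 hba) (add_nonneg (hb.trans hba) hb))
      (sq_nonneg b)]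
  linarith

/-! ### The hard family of Gaussian laws -/

section BlockFamily

variable {n : ℕ}

/-- The vertex `3 q + c`, i.e. the vertex number `c` of the block number `q`. -/
def blockVertex {q : ℕ} (hq : q < n / 3) (c : Fin 3) : Fin n := ⟨3 * q + c, by omega⟩

/-- The center of the block number `q`: its vertex number `0` if `q ∈ B`, number `1` otherwise. -/
def blockCenter (B : Finset ℕ) (q : ℕ) : Fin 3 := if q ∈ B then 0 else 1

/-- Whether `i` is the center of its block. -/
def IsCenter (B : Finset ℕ) (i : Fin n) : Prop := i.1 % 3 = blockCenter B (i.1 / 3)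

instance (B : Finset ℕ) (i : Fin n) : Decidable (IsCenter B i) :=
  inferInstanceAs (Decidable (_ = _))

/-- The correlation matrix in which the vertices are grouped in `⌊n/3⌋` independent blocks of
three, and the at most two vertices left over are independent of all others. In a block, the
center has correlation `a` with the two other vertices, which have correlation `b`. -/
def blockCov (n : ℕ) (B : Finset ℕ) (a b : ℝ) : Matrix (Fin n) (Fin n) ℝ :=
  of fun i j => if i = j then 1 else
    if i.1 / 3 = j.1 / 3 ∧ i.1 / 3 < n / 3 then
      (if IsCenter B i ∨ IsCenter B j then a else b) else 0

variable {B B' : Finset ℕ} {a b : ℝ}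

theorem blockCov_self (i : Fin n) : blockCov n B a b i i = 1 := by simp [blockCov]

theorem blockCov_eq_zero {i j : Fin n} (hij : i ≠ j) (h : ¬(i.1 / 3 = j.1 / 3 ∧ i.1 / 3 < n / 3)) :
    blockCov n B a b i j = 0 := by
  rw [blockCov, of_apply, if_neg hij, if_neg h]

theorem blockCov_posDef (hb : 0 ≤ b) (hba : b ≤ a) (ha : a < 1 / 2) :
    (blockCov n B a b).PosDef := by
  refine posDef_of_sum_abs_lt_one (fun i j => ?_) blockCov_self fun i => ?_
  · by_cases hij : i = j
    · rw [hij]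
    · by_cases h : i.1 / 3 = j.1 / 3 ∧ i.1 / 3 < n / 3
      · simp only [blockCov, of_apply, if_neg hij, if_neg (Ne.symm hij), if_pos h,
          if_pos (show j.1 / 3 = i.1 / 3 ∧ j.1 / 3 < n / 3 by omega), or_comm]
      · rw [blockCov_eq_zero hij h, blockCov_eq_zero (Ne.symm hij) (by omega)]
  · let F : Finset (Fin n) := (Finset.univ.erase i).filter fun j => i.1 / 3 = j.1 / 3
    have hF : F.card ≤ 2 := by
      have h3 : (insert i F).card ≤ 3 := by
        have : (insert i F).card ≤ (Finset.range 3).card := by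
          refine Finset.card_le_card_of_injOn (fun j => j.1 % 3) (fun j _ => ?_) ?_
          · simp [Nat.mod_lt]
          · intro j hj l hl e
            have hblk : ∀ j ∈ insert i F, i.1 / 3 = j.1 / 3 := by
              intro j hj
              rcases Finset.mem_insert.1 hj with rfl | hj
              · rfl
              · exact (Finset.mem_filter.1 hj).2
            have h1 := hblk j hj
            have h2 := hblk l hl
            have e : j.1 % 3 = l.1 % 3 := e
            exact Fin.ext (by omega)
        simpa using this
      rw [Finset.card_insert_of_notMem (by simp [F])] at h3
      omega
    calc
      _ ≤ ∑ j ∈ Finset.univ.erase i, if i.1 / 3 = j.1 / 3 then a else 0 := by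
        refine Finset.sum_le_sum fun j hj => ?_
        have hij : i ≠ j := (Finset.ne_of_mem_erase hj).symm
        by_cases h : i.1 / 3 = j.1 / 3 ∧ i.1 / 3 < n / 3
        · rw [if_pos h.1, blockCov, of_apply, if_neg hij, if_pos h]
          split_ifs
          · exact (abs_of_nonneg (hb.trans hba)).le
          · rwa [abs_of_nonneg hb]
        · rw [blockCov_eq_zero hij h, abs_zero]
          split_ifs
          · exact hb.trans hba
          · exact le_rfl
      _ = F.card * a := by rw [← Finset.sum_filter, Finset.sum_const, nsmul_eq_mul]
      _ ≤ 2 * a := by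
        have : (F.card : ℝ) ≤ 2 := by exact_mod_cast hF
        exact mul_le_mul_of_nonneg_right this (hb.trans hba)
      _ < 1 := by linarith

theorem blockVertex_injective {q : ℕ} (hq : q < n / 3) :
    Function.Injective (blockVertex (n := n) hq) := by
  intro c c' h
  have : 3 * q + c.1 = 3 * q + c'.1 := congrArg Fin.val h
  exact Fin.ext (by omega)

theorem blockVertex_div {q : ℕ} (hq : q < n / 3) (c : Fin 3) : (blockVertex hq c).1 / 3 = q := by
  simp only [blockVertex]
  omega

theorem blockVertex_mod {q : ℕ} (hq : q < n / 3) (c : Fin 3) : (blockVertex hq c).1 % 3 = c := by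
  simp only [blockVertex]
  omega

theorem mem_range_blockVertex {q : ℕ} (hq : q < n / 3) {i : Fin n} :
    i ∈ Set.range (blockVertex hq) ↔ i.1 / 3 = q := by
  constructor
  · rintro ⟨c, rfl⟩
    exact blockVertex_div hq c
  · intro h
    exact ⟨⟨i.1 % 3, Nat.mod_lt _ (by norm_num)⟩, Fin.ext (by simp only [blockVertex]; omega)⟩

theorem isCenter_blockVertex {q : ℕ} (hq : q < n / 3) (c : Fin 3) :
    IsCenter B (blockVertex hq c) ↔ c = blockCenter B q := by
  rw [IsCenter, blockVertex_div, blockVertex_mod, Fin.ext_iff]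

theorem blockCov_blockVertex {q : ℕ} (hq : q < n / 3) (c c' : Fin 3) :
    blockCov n B a b (blockVertex hq c) (blockVertex hq c') = if c = c' then 1 else
      if c = blockCenter B q ∨ c' = blockCenter B q then a else b := by
  simp only [blockCov, of_apply, (blockVertex_injective hq).eq_iff, blockVertex_div,
    isCenter_blockVertex, hq, and_self, if_true]

theorem isSwapPair_blockCov {q : ℕ} (hq : q < n / 3) (hB : q ∈ B) (hB' : q ∉ B')
    (h : ∀ p, p ≠ q → (p ∈ B ↔ p ∈ B')) :
    IsSwapPair (blockCov n B a b) (blockCov n B' a b) (blockVertex hq) a b where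
  inj := blockVertex_injective hq
  block i j := by
    rw [blockCov_blockVertex, blockCenter, if_pos hB]
    fin_cases i <;> fin_cases j <;> simp
  block' i j := by
    rw [blockCov_blockVertex, blockCenter, if_neg hB']
    fin_cases i <;> fin_cases j <;> simp
  left i j hi := blockCov_eq_zero (fun e => hi ⟨j, e.symm⟩) fun e =>
    hi ((mem_range_blockVertex hq).2 (e.1.trans (blockVertex_div hq j)))
  right i j hj := blockCov_eq_zero (fun e => hj ⟨i, e⟩) fun e =>
    hj ((mem_range_blockVertex hq).2 (e.1.symm.trans (blockVertex_div hq i)))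
  left' i j hi := blockCov_eq_zero (fun e => hi ⟨j, e.symm⟩) fun e =>
    hi ((mem_range_blockVertex hq).2 (e.1.trans (blockVertex_div hq j)))
  right' i j hj := blockCov_eq_zero (fun e => hj ⟨i, e⟩) fun e =>
    hj ((mem_range_blockVertex hq).2 (e.1.symm.trans (blockVertex_div hq i)))
  agree i j hi hj := by
    have hi' := h _ fun e => hi ((mem_range_blockVertex hq).2 e)
    have hj' := h _ fun e => hj ((mem_range_blockVertex hq).2 e)
    have hci : IsCenter B i ↔ IsCenter B' i := by simp [IsCenter, blockCenter, hi']
    have hcj : IsCenter B j ↔ IsCenter B' j := by simp [IsCenter, blockCenter, hj']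
    simp only [blockCov, of_apply, hci, hcj]

/-- A sum over all vertices, block by block. -/
theorem sum_eq_sum_blocks {g : Fin n → ℝ} (hg : ∀ i : Fin n, n / 3 ≤ i.1 / 3 → g i = 0) :
    ∑ i, g i = ∑ q : Fin (n / 3), ∑ c, g (blockVertex q.2 c) := by
  have h1 : ∑ i, g i = ∑ i with i.1 / 3 < n / 3, g i := by
    refine (Finset.sum_filter_of_ne fun i _ hi => ?_).symm
    by_contra h
    exact hi (hg i (not_lt.1 h))
  rw [h1, ← Fintype.sum_prod_type' fun (q : Fin (n / 3)) (c : Fin 3) => g (blockVertex q.2 c)]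
  refine (Finset.sum_bij (fun (p : Fin (n / 3) × Fin 3) _ => blockVertex p.1.2 p.2)
    (fun p _ => ?_) (fun p _ p' _ e => ?_) (fun i hi => ?_) fun p _ => rfl).symm
  · rw [Finset.mem_filter]
    exact ⟨Finset.mem_univ _, by rw [blockVertex_div]; exact p.1.2⟩
  · have e1 := congrArg (fun i : Fin n => i.1 / 3) e
    have e2 := congrArg (fun i : Fin n => i.1 % 3) e
    simp only [blockVertex_div, blockVertex_mod] at e1 e2
    exact Prod.ext (Fin.ext e1) (Fin.ext e2)
  · have hi := (Finset.mem_filter.1 hi).2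
    exact ⟨(⟨i.1 / 3, hi⟩, ⟨i.1 % 3, Nat.mod_lt _ (by norm_num)⟩), Finset.mem_univ _,
      Fin.ext (by simp only [blockVertex]; omega)⟩

/-- Some tree contains the two edges at the center of every block. -/
theorem exists_isParentMap_blockCov (hn : 3 ≤ n) (B : Finset ℕ) (a b : ℝ) :
    ∃ (r : Fin n) (pa : Fin n → Fin n) (d : Fin n → ℕ), IsParentMap r pa d ∧
      ∑ i ∈ Finset.univ.erase r, mutualInfo (blockCov n B a b (pa i) i)
        = (n / 3 : ℕ) * (2 * mutualInfo a) := by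
  have h0 : 0 < n / 3 := by omega
  -- the tree joins all centers and all vertices left over to the center of the first block
  let r : Fin n := blockVertex h0 (blockCenter B 0)
  let pa : Fin n → Fin n := fun i =>
    if h : i.1 / 3 < n / 3 then
      if IsCenter B i then r else blockVertex h (blockCenter B (i.1 / 3))
    else r
  let d : Fin n → ℕ := fun i =>
    if i = r then 0 else
      if i.1 / 3 < n / 3 ∧ i.1 / 3 ≠ 0 ∧ ¬ IsCenter B i then 2 else 1
  have hc : ∀ {q : ℕ} (hq : q < n / 3), IsCenter B (blockVertex (n := n) hq (blockCenter B q)) :=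
    fun hq => (isCenter_blockVertex hq _).2 rfl
  have hdr : d r = 0 := if_pos rfl
  have hdc : ∀ {q : ℕ} (hq : q < n / 3),
      d (blockVertex hq (blockCenter B q)) = if q = 0 then 0 else 1 := by
    intro q hq
    by_cases h : q = 0
    · subst h
      exact hdr
    · have : blockVertex hq (blockCenter B q) ≠ r := by
        intro e
        have := congrArg (fun i : Fin n => i.1 / 3) e
        simp only [r, blockVertex_div] at this
        exact h this
      simp [d, this, h, hc hq]
  have hpm : IsParentMap r pa d := by
    refine ⟨hdr, fun i hi => ?_⟩
    by_cases h : i.1 / 3 < n / 3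
    · by_cases hic : IsCenter B i
      · simp [pa, h, hic, d, hi]
      · simp only [pa, h, hic, dif_pos, if_false, hdc]
        by_cases h3 : i.1 / 3 = 0
        · simp only [d]
          rw [if_neg hi, if_neg fun e => e.2.1 h3, if_pos h3]
        · simp only [d]
          rw [if_neg hi, if_pos ⟨h, h3, hic⟩, if_neg h3]
    · simp [pa, h, d, hi]
  refine ⟨r, pa, d, hpm, ?_⟩
  let g : Fin n → ℝ := fun i => if i = r then 0 else mutualInfo (blockCov n B a b (pa i) i)
  have hsum : ∑ i ∈ Finset.univ.erase r, mutualInfo (blockCov n B a b (pa i) i) = ∑ i, g i := by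
    rw [← Finset.add_sum_erase _ _ (Finset.mem_univ r)]
    simp only [g, if_true, zero_add]
    exact Finset.sum_congr rfl fun i hi => (if_neg (Finset.ne_of_mem_erase hi)).symm
  have hgz : ∀ i, ¬((pa i).1 / 3 = i.1 / 3 ∧ (pa i).1 / 3 < n / 3) → g i = 0 := by
    intro i hi
    by_cases hir : i = r
    · simp [g, hir]
    · simp only [g, if_neg hir]
      rw [blockCov_eq_zero (hpm.pa_ne hir) hi, mutualInfo_zero]
  rw [hsum, sum_eq_sum_blocks fun i hi => hgz i (by omega)]
  have hblock : ∀ q : Fin (n / 3), ∑ c, g (blockVertex q.2 c) = 2 * mutualInfo a := by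
    intro q
    have hgc : ∀ c, g (blockVertex q.2 c) = if c = blockCenter B q then 0 else mutualInfo a := by
      intro c
      by_cases hcc : c = blockCenter B q
      · rw [if_pos hcc]
        by_cases hr : blockVertex q.2 c = r
        · simp [g, hr]
        · apply hgz
          intro h
          have hp : pa (blockVertex q.2 c) = r := by
            simp [pa, blockVertex_div, (isCenter_blockVertex q.2 c).2 hcc]
          rw [hp, blockVertex_div] at h
          have hq0 : (0 : ℕ) = q.1 := by
            have h1 := h.1
            rw [blockVertex_div q.2 c] at h1
            exact h1
          apply hr
          rw [hcc]
          apply Fin.ext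
          simp only [r, blockVertex, ← hq0]
      · have hnc : ¬ IsCenter B (blockVertex q.2 c) := by rwa [isCenter_blockVertex]
        have hr : blockVertex q.2 c ≠ r := fun e => hnc (e ▸ hc h0)
        have hp : pa (blockVertex q.2 c) = blockVertex q.2 (blockCenter B q) := by
          have : (blockVertex q.2 c).1 / 3 < n / 3 := by rw [blockVertex_div]; exact q.2
          simp only [pa, this, hnc, dif_pos, if_false]
          simp only [blockVertex_div]
        simp only [g, if_neg hr, if_neg hcc, hp]
        rw [blockCov_blockVertex, if_neg (Ne.symm hcc), if_pos (Or.inl rfl)]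
    simp_rw [hgc, Fin.sum_univ_three, blockCenter]
    split_ifs <;> simp_all <;> ring
  rw [Finset.sum_congr rfl fun q _ => hblock q]
  simp

end BlockFamily

/-! ### The loss of a tree on a law of the hard family -/

/-- In a rooted forest on three vertices, given by an adjacency relation `adj` and depths `D`, let
the edge to the parent of `c` have weight `g c`, which is at most `α` for an edge at `z` and at most
`β` otherwise. The total weight is at most `2 α`, and at most `α + β` if an edge at `z` is
missing. -/
theorem sum_three_le {adj : Fin 3 → Fin 3 → Prop} (hadj : ∀ c c', adj c c' → adj c' c)
    {D : Fin 3 → ℕ} {g : Fin 3 → ℝ} {α β : ℝ} (hβ : 0 ≤ β) (hβα : β ≤ α) (z : Fin 3)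
    (hg : ∀ c, g c ≤ 0 ∨ ∃ c', adj c c' ∧ D c = D c' + 1 ∧ g c ≤ α ∧
      (c ≠ z → c' ≠ z → g c ≤ β)) :
    ∑ c, g c ≤ 2 * α ∧ ((∃ c, c ≠ z ∧ ¬ adj z c) → ∑ c, g c ≤ α + β) := by
  have hα : ∀ c, g c ≤ α := by
    intro c
    rcases hg c with h | ⟨_, _, _, h, _⟩
    · linarith
    · exact h
  -- a vertex of minimal depth has no parent among the three
  have hmin : ∀ c, (∀ c', D c ≤ D c') → g c ≤ 0 := by
    intro c hc
    rcases hg c with h | ⟨c', _, h, _⟩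
    · exact h
    · have := hc c'
      omega
  -- two edges heavier than `β` would both be at `z`, and one of these is missing
  have hpair : (∃ c, c ≠ z ∧ ¬ adj z c) → ∀ c c', c ≠ c' → g c + g c' ≤ α + β := by
    rintro ⟨e, hez, hadje⟩ c₁ c₂ hne
    have hfin : ∀ p q : Fin 3, p ≠ z → q ≠ z → p ≠ q → e = p ∨ e = q := by
      intro p q hp hq hpq
      have key : ∀ z e p q : Fin 3, e ≠ z → p ≠ z → q ≠ z → p ≠ q → e = p ∨ e = q := by decide
      exact key z e p q hez hp hq hpq
    have hno : ∀ p q : Fin 3, p ≠ z → q ≠ z → p ≠ q → adj z p → adj z q → False := by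
      intro p q hp hq hpq h1 h2
      rcases hfin p q hp hq hpq with rfl | rfl
      · exact hadje h1
      · exact hadje h2
    by_contra! hlt
    have h1 : β < g c₁ := by linarith [hα c₂]
    have h2 : β < g c₂ := by linarith [hα c₁]
    obtain ⟨d₁, ha₁, hD₁, -, hz₁⟩ := (hg c₁).resolve_left (by linarith)
    obtain ⟨d₂, ha₂, hD₂, -, hz₂⟩ := (hg c₂).resolve_left (by linarith)
    have hd₁ : c₁ ≠ d₁ := by rintro rfl; omega
    have hd₂ : c₂ ≠ d₂ := by rintro rfl; omega
    by_cases e₁ : c₁ = z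
    · subst e₁
      have e₂ : d₂ = c₁ := by
        by_contra h
        exact absurd (hz₂ hne.symm h) (by linarith)
      subst e₂
      exact hno d₁ c₂ hd₁.symm hne.symm (by rintro rfl; omega) ha₁ (hadj _ _ ha₂)
    · have e₁' : d₁ = z := by
        by_contra h
        exact absurd (hz₁ e₁ h) (by linarith)
      subst e₁'
      by_cases e₂ : c₂ = d₁
      · subst e₂
        exact hno c₁ d₂ hne hd₂.symm (by rintro rfl; omega) (hadj _ _ ha₁) ha₂
      · have e₂' : d₂ = d₁ := by
          by_contra h
          exact absurd (hz₂ e₂ h) (by linarith)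
        subst e₂'
        exact hno c₁ c₂ hd₁ hd₂ hne (hadj _ _ ha₁) (hadj _ _ ha₂)
  have hmin' : (∃ c, g c ≤ 0 ∧ c = 0) ∨ (∃ c, g c ≤ 0 ∧ c = 1) ∨ (∃ c, g c ≤ 0 ∧ c = 2) := by
    obtain ⟨c, hc⟩ := Finite.exists_min D
    have := hmin c hc
    fin_cases c
    · exact Or.inl ⟨0, this, rfl⟩
    · exact Or.inr (Or.inl ⟨1, this, rfl⟩)
    · exact Or.inr (Or.inr ⟨2, this, rfl⟩)
  rw [Fin.sum_univ_three]
  refine ⟨?_, fun h => ?_⟩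
  · have h0 := hα 0
    have h1 := hα 1
    have h2 := hα 2
    rcases hmin' with ⟨c, hc, rfl⟩ | ⟨c, hc, rfl⟩ | ⟨c, hc, rfl⟩ <;> linarith
  · have h01 := hpair h 0 1 (by decide)
    have h02 := hpair h 0 2 (by decide)
    have h12 := hpair h 1 2 (by decide)
    rcases hmin' with ⟨c, hc, rfl⟩ | ⟨c, hc, rfl⟩ | ⟨c, hc, rfl⟩ <;> linarith

theorem isTree_triangle_free {n : ℕ} {T : SimpleGraph (Fin n)} (hT : T.IsTree) {u v w : Fin n}
    (huv : T.Adj u v) (huw : T.Adj u w) (hvw : T.Adj v w) : False := by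
  have h1 := hT.dist_ne_of_adj u hvw
  rw [SimpleGraph.dist_eq_one_iff_adj.2 huv, SimpleGraph.dist_eq_one_iff_adj.2 huw] at h1
  exact h1 rfl

section Loss

variable {n : ℕ} {B : Finset ℕ} {a b : ℝ}

/-- The trees that claim that the vertex number `0` is the center of the block `q`. -/
def claimsZero (q : Fin (n / 3)) : Set (SimpleGraph (Fin n)) :=
  {T | T.Adj (blockVertex q.2 0) (blockVertex q.2 1) ∧
    T.Adj (blockVertex q.2 0) (blockVertex q.2 2)}

/-- The trees whose claim about the center of the block `q` is wrong for the law given by `B`. -/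
def wrongAt (B : Finset ℕ) (q : Fin (n / 3)) : Set (SimpleGraph (Fin n)) :=
  if q.1 ∈ B then (claimsZero q)ᶜ else claimsZero q

/-- A tree that is wrong about a block misses an edge at the center of this block: if it has both
edges at vertex `0` although the center is `1`, it cannot have the edge between `1` and `2`, which
would close a triangle. -/
theorem exists_not_adj_center {T : SimpleGraph (Fin n)} (hT : T.IsTree) {q : Fin (n / 3)}
    (h : T ∈ wrongAt B q) :
    ∃ c, c ≠ blockCenter B q ∧ ¬ T.Adj (blockVertex q.2 (blockCenter B q)) (blockVertex q.2 c) := by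
  unfold wrongAt at h
  unfold blockCenter
  by_cases hq : q.1 ∈ B
  · rw [if_pos hq] at h
    simp only [if_pos hq]
    by_contra! hc
    exact h ⟨hc 1 (by decide), hc 2 (by decide)⟩
  · rw [if_neg hq] at h
    simp only [if_neg hq]
    exact ⟨2, by decide, fun h12 => isTree_triangle_free hT h.1 h.2 h12⟩

/-- An approximate tree has few wrong blocks: each of them costs the difference of the two mutual
informations, compared with the tree that has the edges at all centers. -/
theorem card_wrongAt_le {η : ℝ} (hη : 0 ≤ η) (hn : 3 ≤ n) (hb : 0 ≤ b) (hba : b ≤ a)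
    (ha : a < 1 / 2) {T : SimpleGraph (Fin n)}
    (hT : IsApproxTree (multivariateGaussian 0 (blockCov n B a b)) η T) :
    (∑ q : Fin (n / 3), (wrongAt B q).indicator (fun _ => (1 : ℝ)) T)
      * (mutualInfo a - mutualInfo b) ≤ η := by
  have hS : (blockCov n B a b).PosDef := blockCov_posDef hb hba ha
  obtain ⟨r', pa', harc, hle⟩ := hT.exists_le_sum_mutualInfo hη hS blockCov_self
  obtain ⟨r, pa, d, hpm, hsum⟩ := exists_isParentMap_blockCov hn B a b
  have h1 := hle r pa d hpm
  rw [hsum] at h1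
  have hβ : 0 ≤ mutualInfo b := mutualInfo_nonneg hb (by linarith)
  have hβα : mutualInfo b ≤ mutualInfo a := mutualInfo_mono hb hba (by linarith)
  let g : Fin n → ℝ := fun i => if i = r' then 0 else mutualInfo (blockCov n B a b (pa' i) i)
  have hgsum : ∑ i ∈ Finset.univ.erase r', mutualInfo (blockCov n B a b (pa' i) i) = ∑ i, g i := by
    rw [← Finset.add_sum_erase _ _ (Finset.mem_univ r')]
    simp only [g, if_true, zero_add]
    exact Finset.sum_congr rfl fun i hi => (if_neg (Finset.ne_of_mem_erase hi)).symm
  have hgz : ∀ i, ¬((pa' i).1 / 3 = i.1 / 3 ∧ (pa' i).1 / 3 < n / 3) → g i = 0 := by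
    intro i hi
    by_cases hir : i = r'
    · simp [g, hir]
    · simp only [g, if_neg hir]
      rw [blockCov_eq_zero (harc i hir).1.ne hi, mutualInfo_zero]
  rw [hgsum, sum_eq_sum_blocks fun i hi => hgz i (by omega)] at h1
  have hblock : ∀ q : Fin (n / 3), ∑ c, g (blockVertex q.2 c) ≤ 2 * mutualInfo a
      - (wrongAt B q).indicator (fun _ => (1 : ℝ)) T * (mutualInfo a - mutualInfo b) := by
    intro q
    have key := sum_three_le (adj := fun c c' => T.Adj (blockVertex q.2 c) (blockVertex q.2 c'))
      (fun _ _ h => h.symm) (D := fun c => T.dist r' (blockVertex q.2 c))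
      (g := fun c => g (blockVertex q.2 c)) hβ hβα (blockCenter B q) (fun c => by
        by_cases hcr : blockVertex q.2 c = r'
        · left; simp [g, hcr]
        by_cases hin : (pa' (blockVertex q.2 c)).1 / 3 = q.1
        · right
          obtain ⟨c', hc'⟩ := (mem_range_blockVertex q.2).2 hin
          have harc' := harc _ hcr
          rw [← hc'] at harc'
          have hgc : g (blockVertex q.2 c)
              = mutualInfo (blockCov n B a b (blockVertex q.2 c') (blockVertex q.2 c)) := by
            simp only [g, if_neg hcr, hc']
          have hne : c' ≠ c := by
            rintro rfl
            exact harc'.1.ne rfl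
          refine ⟨c', harc'.1.symm, harc'.2, ?_, fun hc hc' => ?_⟩
          · rw [hgc, blockCov_blockVertex, if_neg hne]
            split_ifs
            · exact le_rfl
            · exact hβα
          · rw [hgc, blockCov_blockVertex, if_neg hne, if_neg (by tauto)]
        · left
          rw [hgz]
          rw [blockVertex_div]
          exact fun h => hin h.1)
    by_cases hw : T ∈ wrongAt B q
    · rw [Set.indicator_of_mem hw]
      have := key.2 (exists_not_adj_center hT.1 hw)
      linarith
    · rw [Set.indicator_of_notMem hw]
      have := key.1
      linarith
  have h2 := Finset.sum_le_sum fun q (_ : q ∈ Finset.univ) => hblock q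
  rw [Finset.sum_sub_distrib, Finset.sum_const, Finset.card_univ, Fintype.card_fin, nsmul_eq_mul,
    ← Finset.sum_mul] at h2
  linarith

end Loss

/-! ### Averaging over the hard family -/

section Averaging

variable {n m : ℕ}

/-- The law of the output of the algorithm `A` on `m` independent samples from `N(0, S)`. -/
noncomputable def outputLaw (A : Kernel (Fin m → Sample n) (SimpleGraph (Fin n)))
    (S : Matrix (Fin n) (Fin n) ℝ) : Measure (SimpleGraph (Fin n)) :=
  (Measure.pi fun _ : Fin m => multivariateGaussian 0 S).bind A

instance (A : Kernel (Fin m → Sample n) (SimpleGraph (Fin n))) [IsMarkovKernel A]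
    (S : Matrix (Fin n) (Fin n) ℝ) : IsProbabilityMeasure (outputLaw A S) := by
  unfold outputLaw
  infer_instance

theorem Succeeds.real_compl_le {A : Kernel (Fin m → Sample n) (SimpleGraph (Fin n))}
    [IsMarkovKernel A] {η : ℝ} (hA : Succeeds A η (9 / 10)) {S : Matrix (Fin n) (Fin n) ℝ}
    (hS : S.PosDef) :
    (outputLaw A S).real {T | IsApproxTree (multivariateGaussian 0 S) η T}ᶜ ≤ 1 / 10 := by
  have h1 : (9 / 10 : ℝ) ≤ (outputLaw A S).real
      {T | IsApproxTree (multivariateGaussian 0 S) η T} := by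
    have h := (ENNReal.toReal_le_toReal (by finiteness) (measure_ne_top _ _)).2 (hA S hS)
    simpa [outputLaw, measureReal_def] using h
  rw [probReal_compl_eq_one_sub (by exact MeasurableSpace.measurableSet_top)]
  linarith

theorem measurableSet_graph (s : Set (SimpleGraph (Fin n))) : MeasurableSet s :=
  MeasurableSpace.measurableSet_top

/-- On average over the output of the algorithm, few blocks are wrong. -/
theorem Succeeds.sum_wrongAt_le {A : Kernel (Fin m → Sample n) (SimpleGraph (Fin n))}
    [IsMarkovKernel A] {η a b : ℝ} (hA : Succeeds A η (9 / 10)) (hη : 0 ≤ η) (hn : 3 ≤ n)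
    (hb : 0 ≤ b) (hba : b ≤ a) (ha : a < 1 / 2) (hlt : 0 < mutualInfo a - mutualInfo b)
    (B : Finset ℕ) :
    ∑ q : Fin (n / 3), (outputLaw A (blockCov n B a b)).real (wrongAt B q)
      ≤ η / (mutualInfo a - mutualInfo b) + (n / 3 : ℕ) / 10 := by
  set S := blockCov n B a b with hSdef
  have hS : S.PosDef := blockCov_posDef hb hba ha
  set G : Set (SimpleGraph (Fin n)) := {T | IsApproxTree (multivariateGaussian 0 S) η T} with hG
  have hint : ∀ s : Set (SimpleGraph (Fin n)),
      Integrable (s.indicator fun _ => (1 : ℝ)) (outputLaw A S) := fun s =>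
    (integrable_const _).indicator (measurableSet_graph s)
  have hreal : ∀ s : Set (SimpleGraph (Fin n)),
      ∫ T, s.indicator (fun _ => (1 : ℝ)) T ∂(outputLaw A S) = (outputLaw A S).real s := by
    intro s
    rw [integral_indicator_const _ (measurableSet_graph s)]
    simp
  have hpt : ∀ T, ∑ q : Fin (n / 3), (wrongAt B q).indicator (fun _ => (1 : ℝ)) T
      ≤ η / (mutualInfo a - mutualInfo b)
        + (n / 3 : ℕ) * Gᶜ.indicator (fun _ => (1 : ℝ)) T := by
    intro T
    by_cases hT : T ∈ G
    · rw [Set.indicator_of_notMem (by simpa using hT), mul_zero, add_zero, le_div_iff₀ hlt]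
      exact card_wrongAt_le hη hn hb hba ha hT
    · rw [Set.indicator_of_mem (by simpa using hT), mul_one]
      have : ∑ q : Fin (n / 3), (wrongAt B q).indicator (fun _ => (1 : ℝ)) T
          ≤ ∑ q : Fin (n / 3), 1 := Finset.sum_le_sum fun q _ =>
        Set.indicator_le_self' (fun _ _ => zero_le_one) T
      rw [Finset.sum_const, Finset.card_univ, Fintype.card_fin, nsmul_eq_mul, mul_one] at this
      have h0 : 0 ≤ η / (mutualInfo a - mutualInfo b) := by positivity
      linarith
  calc
    _ = ∫ T, ∑ q : Fin (n / 3), (wrongAt B q).indicator (fun _ => (1 : ℝ)) T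
          ∂(outputLaw A S) := by
      rw [integral_finsetSum _ fun q _ => hint _]
      exact Finset.sum_congr rfl fun q _ => (hreal _).symm
    _ ≤ ∫ T, (η / (mutualInfo a - mutualInfo b)
          + (n / 3 : ℕ) * Gᶜ.indicator (fun _ => (1 : ℝ)) T) ∂(outputLaw A S) :=
      integral_mono (integrable_finsetSum _ fun q _ => hint _)
        ((integrable_const _).add ((hint _).const_mul _)) hpt
    _ = η / (mutualInfo a - mutualInfo b) + (n / 3 : ℕ) * (outputLaw A S).real Gᶜ := by
      rw [integral_add (integrable_const _) ((hint _).const_mul _), integral_const_mul, hreal]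
      simp
    _ ≤ _ := by
      have := mul_le_mul_of_nonneg_left (hA.real_compl_le hS) (Nat.cast_nonneg (n / 3) : (0:ℝ) ≤ _)
      linarith

/-- For two laws of the family that differ in the block `q`, the algorithm is wrong about this
block with substantial probability under one of the two. -/
theorem wrongAt_add_wrongAt_ge (A : Kernel (Fin m → Sample n) (SimpleGraph (Fin n)))
    [IsMarkovKernel A] {a b : ℝ} (hb : 0 ≤ b) (hba : b ≤ a) (ha : a < 1 / 2)
    (hD : blockDet a b ≠ 0) (B : Finset ℕ) (q : Fin (n / 3)) :
    2 / 3 * (1 - m * ((a - b) ^ 2 * (1 + a) / blockDet a b))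
      ≤ (outputLaw A (blockCov n B a b)).real (wrongAt B q)
        + (outputLaw A (blockCov n (symmDiff B {q.1}) a b)).real
            (wrongAt (symmDiff B {q.1}) q) := by
  have key : ∀ B B' : Finset ℕ, q.1 ∈ B → q.1 ∉ B' → (∀ p, p ≠ q.1 → (p ∈ B ↔ p ∈ B')) →
      2 / 3 * (1 - m * ((a - b) ^ 2 * (1 + a) / blockDet a b))
        ≤ (outputLaw A (blockCov n B a b)).real (wrongAt B q)
          + (outputLaw A (blockCov n B' a b)).real (wrongAt B' q) := by
    intro B B' hB hB' h
    have := (isSwapPair_blockCov (a := a) (b := b) q.2 hB hB' h).testing_error_ge hD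
      (blockCov_posDef hb hba ha) (blockCov_posDef hb hba ha) A
      (measurableSet_graph (claimsZero q)ᶜ)
    rw [compl_compl] at this
    rwa [wrongAt, wrongAt, if_pos hB, if_neg hB']
  by_cases hB : q.1 ∈ B
  · exact key B (symmDiff B {q.1}) hB (by simp [Finset.mem_symmDiff, hB])
      fun p hp => by simp [Finset.mem_symmDiff, hp]
  · refine (key (symmDiff B {q.1}) B (by simp [Finset.mem_symmDiff, hB]) hB
      fun p hp => by simp [Finset.mem_symmDiff, hp]).trans_eq (add_comm _ _)

/-- The expected number of wrong blocks, averaged over all laws of the family, is at least the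
left-hand side by the testing bound, and at most the right-hand side since the algorithm
succeeds. -/
theorem Succeeds.averaging {A : Kernel (Fin m → Sample n) (SimpleGraph (Fin n))}
    [IsMarkovKernel A] {η a b : ℝ} (hA : Succeeds A η (9 / 10)) (hη : 0 ≤ η) (hn : 3 ≤ n)
    (hb : 0 ≤ b) (hba : b ≤ a) (ha : a < 1 / 2) (hlt : 0 < mutualInfo a - mutualInfo b)
    (hD : blockDet a b ≠ 0) :
    (n / 3 : ℕ) * (1 / 3 * (1 - m * ((a - b) ^ 2 * (1 + a) / blockDet a b)))
      ≤ η / (mutualInfo a - mutualInfo b) + (n / 3 : ℕ) / 10 := by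
  set w := 1 - m * ((a - b) ^ 2 * (1 + a) / blockDet a b) with hw
  set 𝓑 := (Finset.range (n / 3)).powerset with h𝓑
  set W : Finset ℕ → Fin (n / 3) → ℝ := fun B q =>
    (outputLaw A (blockCov n B a b)).real (wrongAt B q) with hW
  have hcard : (0 : ℝ) < 𝓑.card := by
    exact_mod_cast Finset.card_pos.2 ⟨∅, by simp [h𝓑]⟩
  have hlow : ∀ q, 𝓑.card * (1 / 3 * w) ≤ ∑ B ∈ 𝓑, W B q := by
    intro q
    -- moving the center of the block `q` is an involution of the family
    have hflip : ∑ B ∈ 𝓑, W (symmDiff B {q.1}) q = ∑ B ∈ 𝓑, W B q := by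
      have hmem : ∀ B ∈ 𝓑, symmDiff B {q.1} ∈ 𝓑 := by
        intro B hB
        rw [h𝓑, Finset.mem_powerset] at hB ⊢
        intro p hp
        rcases Finset.mem_symmDiff.1 hp with ⟨hp, -⟩ | ⟨hp, -⟩
        · exact hB hp
        · rw [Finset.mem_singleton.1 hp, Finset.mem_range]
          exact q.2
      exact Finset.sum_nbij' (fun B => symmDiff B {q.1}) (fun B => symmDiff B {q.1}) hmem hmem
        (fun B _ => symmDiff_symmDiff_cancel_right _ _)
        (fun B _ => symmDiff_symmDiff_cancel_right _ _) fun B _ => rfl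
    have h2 : 𝓑.card * (2 / 3 * w) ≤ ∑ B ∈ 𝓑, (W B q + W (symmDiff B {q.1}) q) := by
      rw [← nsmul_eq_mul]
      exact Finset.card_nsmul_le_sum _ _ _ fun B _ => wrongAt_add_wrongAt_ge A hb hba ha hD B q
    rw [Finset.sum_add_distrib, hflip] at h2
    linarith
  have h1 : (n / 3 : ℕ) * (𝓑.card * (1 / 3 * w)) ≤ ∑ q, ∑ B ∈ 𝓑, W B q := by
    have := Finset.card_nsmul_le_sum Finset.univ _ _ fun q (_ : q ∈ Finset.univ) => hlow q
    rwa [Finset.card_univ, Fintype.card_fin, nsmul_eq_mul] at this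
  have h2 : ∑ B ∈ 𝓑, ∑ q, W B q
      ≤ 𝓑.card * (η / (mutualInfo a - mutualInfo b) + (n / 3 : ℕ) / 10) := by
    rw [← nsmul_eq_mul]
    exact Finset.sum_le_card_nsmul _ _ _ fun B _ => hA.sum_wrongAt_le hη hn hb hba ha hlt B
  rw [Finset.sum_comm] at h1
  have h3 := h1.trans h2
  rw [mul_left_comm] at h3
  exact le_of_mul_le_mul_left h3 hcard

/-- The sample complexity bound in the range of `ε` in which the correlations `1/4 + ε/n` and `1/4`
define a law of the hard family. -/
theorem Succeeds.le_of_small {A : Kernel (Fin m → Sample n) (SimpleGraph (Fin n))}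
    [IsMarkovKernel A] {ε : ℝ} (hε : 0 < ε) (hn : 3 ≤ n) (hεn : ε ≤ n / 8)
    (hA : Succeeds A (ε / 200) (9 / 10)) : 1 / 64 * (n : ℝ) ^ 2 / ε ^ 2 ≤ m := by
  have hn0 : (0 : ℝ) < n := by exact_mod_cast (by omega : 0 < n)
  set δ := ε / n with hδ
  have hδ0 : 0 < δ := by positivity
  have hδ1 : δ ≤ 1 / 8 := by
    rw [hδ, div_le_iff₀ hn0]
    linarith
  have hεδ : ε = δ * n := by rw [hδ]; field_simp
  have hk : (n : ℝ) ≤ 5 * (n / 3 : ℕ) := by exact_mod_cast (by omega : n ≤ 5 * (n / 3))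
  have hk0 : (0 : ℝ) < (n / 3 : ℕ) := by exact_mod_cast (by omega : 0 < n / 3)
  have hgap : δ / 4 ≤ mutualInfo (1 / 4 + δ) - mutualInfo (1 / 4) := by
    have := mutualInfo_sub_ge (a := 1 / 4 + δ) (b := 1 / 4) (by norm_num) (by linarith)
      (by linarith)
    nlinarith
  have hlt : 0 < mutualInfo (1 / 4 + δ) - mutualInfo (1 / 4) := by linarith
  have hdet : 11 / 16 ≤ blockDet (1 / 4 + δ) (1 / 4) := by
    unfold blockDet
    nlinarith
  have hdet0 : 0 < blockDet (1 / 4 + δ) (1 / 4) := by linarith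
  have key := hA.averaging (a := 1 / 4 + δ) (b := 1 / 4) (by positivity) hn (by norm_num)
    (by linarith) (by linarith) hlt hdet0.ne'
  have hloss : ε / 200 / (mutualInfo (1 / 4 + δ) - mutualInfo (1 / 4)) ≤ (n / 3 : ℕ) / 10 := by
    rw [div_le_iff₀ hlt]
    calc
      ε / 200 = (n : ℝ) / 50 * (δ / 4) := by rw [hεδ]; ring
      _ ≤ (n / 3 : ℕ) / 10 * (δ / 4) := by
        refine mul_le_mul_of_nonneg_right ?_ (by positivity)
        linarith
      _ ≤ _ := by gcongr
  have hkl : (1 / 4 + δ - 1 / 4) ^ 2 * (1 + (1 / 4 + δ)) / blockDet (1 / 4 + δ) (1 / 4)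
      ≤ 2 * δ ^ 2 := by
    rw [div_le_iff₀ hdet0]
    have e : (1 / 4 + δ - 1 / 4) ^ 2 = δ ^ 2 := by ring
    rw [e]
    have : 1 + (1 / 4 + δ) ≤ 2 * blockDet (1 / 4 + δ) (1 / 4) := by linarith
    nlinarith [sq_nonneg δ]
  set κ := (1 / 4 + δ - 1 / 4) ^ 2 * (1 + (1 / 4 + δ)) / blockDet (1 / 4 + δ) (1 / 4) with hκ
  -- the bounds `1 / 10` on the loss and on the failure probability add up
  have h1 : 1 / 3 * (1 - m * κ) ≤ 1 / 5 := by
    refine le_of_mul_le_mul_left ?_ hk0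
    linarith
  have h2 : (m : ℝ) * κ ≤ m * (2 * δ ^ 2) := mul_le_mul_of_nonneg_left hkl (Nat.cast_nonneg m)
  have h3 : 1 / 5 ≤ m * δ ^ 2 := by linarith
  have h4 : 1 / 64 * (n : ℝ) ^ 2 / ε ^ 2 = 1 / 64 / δ ^ 2 := by
    rw [hεδ]; field_simp
  rw [h4, div_le_iff₀ (by positivity)]
  linarith

end Averaging

/-! ### At least one sample is needed -/

section NoSample

variable {n : ℕ} {u w : Fin n} {τ : ℝ}

/-- The correlation matrix in which `u` and `w` have correlation `τ`, all other pairs being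
independent. -/
def pairCov (u w : Fin n) (τ : ℝ) : Matrix (Fin n) (Fin n) ℝ :=
  of fun i j => if i = j then 1 else if (i = u ∧ j = w) ∨ (i = w ∧ j = u) then τ else 0

theorem pairCov_posDef (h0 : 0 ≤ τ) (h1 : τ < 1) : (pairCov u w τ).PosDef := by
  refine posDef_of_sum_abs_lt_one (fun i j => ?_) (fun i => by simp [pairCov]) fun i => ?_
  · simp only [pairCov, of_apply, eq_comm (a := j) (b := i), and_comm, or_comm]
  · refine lt_of_le_of_lt ?_ h1
    calc
      _ ≤ ∑ j ∈ Finset.univ.erase i, if j = (if i = u then w else u) then τ else 0 := by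
        refine Finset.sum_le_sum fun j hj => ?_
        have hij : i ≠ j := (Finset.ne_of_mem_erase hj).symm
        rw [pairCov, of_apply, if_neg hij]
        by_cases h : (i = u ∧ j = w) ∨ (i = w ∧ j = u)
        · rw [if_pos h, abs_of_nonneg h0, if_pos]
          rcases h with ⟨hi, hj⟩ | ⟨hi, hj⟩
          · rw [if_pos hi, hj]
          · rw [if_neg (fun e => hij (e.trans hj.symm)), hj]
        · rw [if_neg h, abs_zero]
          split_ifs <;> first | exact h0 | exact le_rfl
      _ ≤ ∑ j, if j = (if i = u then w else u) then τ else 0 :=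
        Finset.sum_le_sum_of_subset_of_nonneg (Finset.erase_subset _ _) fun j _ _ => by
          split_ifs <;> first | exact h0 | exact le_rfl
      _ = τ := by simp

/-- A tree that misses the edge between two strongly correlated vertices is not approximately
optimal. -/
theorem IsApproxTree.adj_of_pairCov {η : ℝ} (hη : 0 ≤ η) (huw : u ≠ w) (h0 : 0 ≤ τ) (h1 : τ < 1)
    (hτ : η < mutualInfo τ) {T : SimpleGraph (Fin n)}
    (hT : IsApproxTree (multivariateGaussian 0 (pairCov u w τ)) η T) : T.Adj u w := by
  by_contra hadj
  obtain ⟨r', pa', harc, hle⟩ := hT.exists_le_sum_mutualInfo hη (pairCov_posDef h0 h1)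
    fun i => by simp [pairCov]
  have hpm : IsParentMap u (fun _ => u) fun i => if i = u then 0 else 1 :=
    ⟨if_pos rfl, fun i hi => by simp [hi]⟩
  have h2 := hle _ _ _ hpm
  have h3 : ∑ i ∈ Finset.univ.erase r', mutualInfo (pairCov u w τ (pa' i) i) = 0 := by
    refine Finset.sum_eq_zero fun i hi => ?_
    have ha := (harc i (Finset.ne_of_mem_erase hi)).1
    rw [pairCov, of_apply, if_neg ha.ne, if_neg, mutualInfo_zero]
    rintro (⟨e1, e2⟩ | ⟨e1, e2⟩)
    · rw [e1, e2] at ha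
      exact hadj ha
    · rw [e1, e2] at ha
      exact hadj ha.symm
  have h4 : mutualInfo τ ≤ ∑ i ∈ Finset.univ.erase u, mutualInfo (pairCov u w τ u i) := by
    have h5 : mutualInfo τ = mutualInfo (pairCov u w τ u w) := by simp [pairCov, huw]
    rw [h5]
    refine Finset.single_le_sum (f := fun i => mutualInfo (pairCov u w τ u i)) (fun i hi => ?_)
      (Finset.mem_erase.2 ⟨huw.symm, Finset.mem_univ w⟩)
    simp only [pairCov, of_apply, if_neg (Finset.ne_of_mem_erase hi).symm]
    split_ifs
    · exact mutualInfo_nonneg h0 h1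
    · exact mutualInfo_zero.ge
  linarith

theorem exists_mutualInfo_gt (η : ℝ) (hη : 0 ≤ η) : ∃ τ, 0 ≤ τ ∧ τ < 1 ∧ η < mutualInfo τ := by
  have h1 : Real.exp (-(2 * (η + 1))) ≤ 1 := Real.exp_le_one_iff.2 (by linarith)
  have h2 := Real.exp_pos (-(2 * (η + 1)))
  -- the correlation with mutual information `η + 1`
  refine ⟨√(1 - Real.exp (-(2 * (η + 1)))), Real.sqrt_nonneg _, ?_, ?_⟩
  · rw [Real.sqrt_lt' one_pos]
    linarith
  · rw [mutualInfo, Real.sq_sqrt (by linarith), sub_sub_cancel, Real.log_exp]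
    linarith

/-- Without samples, the same tree would have to contain the edges of a triangle: the laws of the
output under three laws with one strongly correlated pair each are the same. -/
theorem Succeeds.pos {m : ℕ} {A : Kernel (Fin m → Sample n) (SimpleGraph (Fin n))}
    [IsMarkovKernel A] {η : ℝ} (hη : 0 ≤ η) (hn : 3 ≤ n) (hA : Succeeds A η (9 / 10)) :
    0 < m := by
  rcases Nat.eq_zero_or_pos m with rfl | hm
  swap
  · exact hm
  obtain ⟨τ, h0, h1, hτ⟩ := exists_mutualInfo_gt η hη
  have hconst : ∀ S S', outputLaw A S = outputLaw A S' := fun S S' => by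
    rw [outputLaw, outputLaw, Measure.pi_of_empty, Measure.pi_of_empty]
  -- the choice of the matrix is immaterial here
  set ν := outputLaw A (1 : Matrix (Fin n) (Fin n) ℝ) with hν
  let Good : Fin n → Fin n → Set (SimpleGraph (Fin n)) := fun u w =>
    {T | IsApproxTree (multivariateGaussian 0 (pairCov u w τ)) η T}
  have hgood : ∀ u w : Fin n, ν.real (Good u w)ᶜ ≤ 1 / 10 := fun u w => by
    rw [hν, hconst _ (pairCov u w τ)]
    exact hA.real_compl_le (pairCov_posDef h0 h1)
  let a : Fin n := ⟨0, by omega⟩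
  let b : Fin n := ⟨1, by omega⟩
  let c : Fin n := ⟨2, by omega⟩
  have hab : a ≠ b := by simp [a, b]
  have hac : a ≠ c := by simp [a, c]
  have hbc : b ≠ c := by simp [b, c]
  have hcover : (Set.univ : Set (SimpleGraph (Fin n)))
      ⊆ (Good a b)ᶜ ∪ ((Good a c)ᶜ ∪ (Good b c)ᶜ) := by
    intro T _
    by_contra hT
    simp only [Set.mem_union, Set.mem_compl_iff, not_or, not_not] at hT
    obtain ⟨g1, g2, g3⟩ := hT
    exact isTree_triangle_free g1.1 (g1.adj_of_pairCov hη hab h0 h1 hτ)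
      (g2.adj_of_pairCov hη hac h0 h1 hτ) (g3.adj_of_pairCov hη hbc h0 h1 hτ)
  have h2 := measureReal_mono (μ := ν) hcover
  rw [probReal_univ] at h2
  have h3 := measureReal_union_le (μ := ν) (Good a b)ᶜ ((Good a c)ᶜ ∪ (Good b c)ᶜ)
  have h4 := measureReal_union_le (μ := ν) (Good a c)ᶜ (Good b c)ᶜ
  linarith [hgood a b, hgood a c, hgood b c]

end NoSample

end GaussianTree

theorem mainTheorem6 :
    ∃ c : ℝ, 0 < c ∧ ∀ (n : ℕ), 3 ≤ n → ∀ (ε : ℝ), 0 < ε →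
      ∀ (m : ℕ) (A : ProbabilityTheory.Kernel (Fin m → GaussianTree.Sample n)
          (SimpleGraph (Fin n))) (_ : ProbabilityTheory.IsMarkovKernel A),
        GaussianTree.Succeeds A (ε / 200) (9 / 10) →
          c * (n : ℝ) ^ 2 / ε ^ 2 ≤ (m : ℝ) := by
  refine ⟨1 / 64, by norm_num, fun n hn ε hε m A _ hA => ?_⟩
  rcases le_total ε (n / 8) with h | h
  · exact hA.le_of_small hε hn h
  · -- here the bound is at most one
    have hm : (1 : ℝ) ≤ m := by exact_mod_cast hA.pos (by positivity) hn
    refine le_trans ?_ hm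
    rw [div_le_one (by positivity)]
    have hn0 : (0 : ℝ) ≤ n := Nat.cast_nonneg n
    nlinarith
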